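/- Let $p$ be a prime and $\delta=z\frac{d}{dz}$. For $f=\sum_k a_kz^k\in\mathbb{Q}_p[[z]]$ let $|f|_{\mathcal G}=\sup_k|a_k|_p\in[0,\infty]$ be its Gauss norm, let $\mathcal{B}\subset\mathbb{Q}_p[[z]]$ be the ring of power series with bounded coefficients (the intersection of $\mathbb{Q}_p[[z]]$ with the Amice ring), and for a square matrix $C=(c_{i,j})$ put $\|C\|=\max_{i,j}|c_{i,j}|_{\mathcal G}$. Let $\Lambda_p(\sum_i a_iz^i)=\sum_i a_{ip}z^i$ be the Cartier operator; $\delta$, $\Lambda_p$ and substitutions are applied to matrices entrywise. A monic operator $L=\delta^n+a_{n-1}\delta^{n-1}+\cdots+a_0$ of order $n\ge 1$ with $a_i\in\mathbb{Q}_p[[z]]$ is called MUM if $a_i\in z\mathbb{Q}_p[[z]]$ for all $i$. Its companion matrix $A$ is the $n\times n$ matrix with ones on the superdiagonal, last row $(-a_0,\dots,-a_{n-1})$, and zeros elsewhere. If $L$ is MUM, then $N=A(0)$ is nilpotent, and the system $\delta X=AX$ has a unique solution of the form $Y_Lz^N$ with $Y_L\in GL_n(\mathbb{Q}_p[[z]])$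 and $Y_L(0)=I$, where $z^N=\sum_{j=0}^{n-1}N^j\frac{(\mathrm{Log}\,z)^j}{j!}$, $\mathrm{Log}\,z$ being transcendental over $\mathbb{Q}_p[[z]]$ with $\delta(\mathrm{Log}\,z)=1$; it is called the fundamental matrix of solutions of $\delta X=AX$. The radius of convergence $\bm{r}(L)\in[0,\infty]$ is defined by $\frac1{\bm{r}(L)}=\limsup_{j\to\infty}\left\|\frac{A_j}{j!}\right\|^{1/j}$, where $A_0=I$ and $A_{j+1}=\delta A_j+A_j(A-jI)$. **Proposition.** Let $L$ be a MUM differential operator of order $n\geq 1$ in $\mathbb{Z}_p[[z]][\delta]$ with companion matrix $A$, let $N=A(0)$, and let $Y_Lz^N$ be the fundamental matrix of solutions of $\delta X=AX$. If $\bm{r}(L)\ge1$, then for every integer $m>0$ there is a MUM differential operator $L_m$ of order $n$ in $\mathbb{Z}_p[[z]][\delta]$, with companion matrix $B_m$, such that: (a) the fundamental matrix of solutions of $\delta X=B_mX$ is $$\mathrm{diag}(1,p^{-m},\dots,p^{-m(n-1)})\,\Lambda_p^m(Y_L)\,\mathrm{diag}(1,p^m,\dots,p^{m(n-1)})\,z^N;$$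 (b) the matrix $H_m=Y_L\,\bigl(\Lambda_p^m(Y_L)(z^{p^m})\bigr)^{-1}\mathrm{diag}(1,p^m,\dots,p^{m(n-1)})$ belongs to $M_n(\mathbb{Z}_p[[z]])\cap GL_n(\mathcal{B})$, satisfies $\|H_m\|=1$, and $$\delta H_m=AH_m-p^mH_mB_m(z^{p^m});$$ (c) $\bm{r}(L_m)\ge1$. -/

import Mathlib

open scoped ENNReal PowerSeries

namespace PadicMUM

variable (p : ℕ) [Fact p.Prime]

/-- The derivation `δ = z d/dz` on `ℚ_p[[z]]`. -/
noncomputable def delta : Derivation ℚ_[p] ℚ_[p]⟦X⟧ ℚ_[p]⟦X⟧ :=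
  (PowerSeries.X : ℚ_[p]⟦X⟧) • PowerSeries.derivative ℚ_[p]

/-- The Gauss norm `sup_k |a_k|` of a power series `∑ a_k z^k`, with values in `[0, ∞]`
(so that it is `∞` exactly when the coefficients are unbounded). -/
noncomputable def gaussNorm (f : ℚ_[p]⟦X⟧) : ℝ≥0∞ := ⨆ k, ‖PowerSeries.coeff k f‖ₑ

/-- `‖M‖`: the maximum of the Gauss norms of the entries of `M`. -/
noncomputable def matNorm {n : ℕ} (M : Matrix (Fin n) (Fin n) ℚ_[p]⟦X⟧) : ℝ≥0∞ :=
  ⨆ i, ⨆ j, gaussNorm p (M i j)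

theorem gaussNorm_ne_top_iff (f : ℚ_[p]⟦X⟧) :
    gaussNorm p f ≠ ∞ ↔ ∃ C : ℝ, ∀ k, ‖PowerSeries.coeff k f‖ ≤ C := by
  constructor
  · intro h
    refine ⟨(gaussNorm p f).toReal, fun k => ?_⟩
    have h1 : ‖PowerSeries.coeff k f‖ₑ ≤ gaussNorm p f :=
      le_iSup (fun k => ‖PowerSeries.coeff k f‖ₑ) k
    have h2 := ENNReal.toReal_mono h h1
    simpa using h2
  · rintro ⟨C, hC⟩
    refine ne_top_of_le_ne_top (ENNReal.ofReal_ne_top (r := C)) (iSup_le fun k => ?_)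
    rw [← ofReal_norm]
    exact ENNReal.ofReal_le_ofReal (hC k)

/-- The ring of power series over `ℚ_p` with bounded coefficients: the intersection of
`ℚ_p[[z]]` with the Amice ring. -/
def boundedSeries : Subring ℚ_[p]⟦X⟧ where
  carrier := {f | gaussNorm p f ≠ ∞}
  zero_mem' := (gaussNorm_ne_top_iff p _).2 ⟨0, by simp⟩
  one_mem' := (gaussNorm_ne_top_iff p _).2 ⟨1, fun k => by
    rw [PowerSeries.coeff_one]; split_ifs <;> simp⟩
  neg_mem' := by
    intro f hf
    obtain ⟨C, hC⟩ := (gaussNorm_ne_top_iff p _).1 hf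
    exact (gaussNorm_ne_top_iff p _).2 ⟨C, by simpa using hC⟩
  add_mem' := by
    intro f g hf hg
    obtain ⟨C, hC⟩ := (gaussNorm_ne_top_iff p _).1 hf
    obtain ⟨D, hD⟩ := (gaussNorm_ne_top_iff p _).1 hg
    refine (gaussNorm_ne_top_iff p _).2 ⟨C + D, fun k => ?_⟩
    rw [map_add]
    exact (norm_add_le _ _).trans (add_le_add (hC k) (hD k))
  mul_mem' := by
    intro f g hf hg
    obtain ⟨C, hC⟩ := (gaussNorm_ne_top_iff p _).1 hf
    obtain ⟨D, hD⟩ := (gaussNorm_ne_top_iff p _).1 hg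
    have hC0 : 0 ≤ C := (norm_nonneg _).trans (hC 0)
    have hD0 : 0 ≤ D := (norm_nonneg _).trans (hD 0)
    refine (gaussNorm_ne_top_iff p _).2 ⟨C * D, fun k => ?_⟩
    rw [PowerSeries.coeff_mul]
    refine IsUltrametricDist.norm_sum_le_of_forall_le_of_nonneg (mul_nonneg hC0 hD0) ?_
    intro x _
    rw [norm_mul]
    exact mul_le_mul (hC _) (hD _) (norm_nonneg _) hC0

/-- The subring `ℤ_p[[z]]` of `ℚ_p[[z]]`. -/
noncomputable def integralSeries : Subring ℚ_[p]⟦X⟧ :=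
  (PowerSeries.map (algebraMap ℤ_[p] ℚ_[p])).range

/-- A monic differential operator `δ^n + a_{n-1} δ^{n-1} + ⋯ + a_1 δ + a_0` of order `n` with
coefficients in `ℚ_p[[z]]`, given by its coefficients: `coeff i` is `a_i`. -/
@[ext] structure MonicDiffOp (n : ℕ) where
  coeff : Fin n → ℚ_[p]⟦X⟧

variable {p} {n : ℕ}

/-- `L` belongs to `ℤ_p[[z]][δ]`. -/
def MonicDiffOp.IsIntegral (L : MonicDiffOp p n) : Prop := ∀ i, L.coeff i ∈ integralSeries p

/-- `L` is MUM: its coefficients belong to `z ℚ_p[[z]]`. -/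
def MonicDiffOp.IsMUM (L : MonicDiffOp p n) : Prop :=
  ∀ i, PowerSeries.constantCoeff (L.coeff i) = 0

/-- The companion matrix of `L`: ones on the superdiagonal and last row
`-a_0, -a_1, …, -a_{n-1}`. -/
noncomputable def MonicDiffOp.companion (L : MonicDiffOp p n) : Matrix (Fin n) (Fin n) ℚ_[p]⟦X⟧ :=
  Matrix.of fun i j =>
    if (i : ℕ) + 1 = n then -L.coeff j else if (j : ℕ) = i + 1 then 1 else 0

/-- The value `M(0)` of a matrix of power series. -/
noncomputable def evalZero (M : Matrix (Fin n) (Fin n) ℚ_[p]⟦X⟧) : Matrix (Fin n) (Fin n) ℚ_[p] :=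
  M.map PowerSeries.constantCoeff

/-- The derivation `δ` on `ℚ_p[[z]][Log z]`, where `Log z` is the polynomial variable (it is
transcendental over `ℚ_p[[z]]`) and `δ(Log z) = 1`:
`δ(∑ f_k (Log z)^k) = ∑ δ(f_k) (Log z)^k + ∑ k f_k (Log z)^(k-1)`. -/
noncomputable def logDelta (P : Polynomial ℚ_[p]⟦X⟧) : Polynomial ℚ_[p]⟦X⟧ :=
  (P.sum fun k f => Polynomial.monomial k (delta p f)) + Polynomial.derivative P

/-- A matrix of power series, viewed as a matrix over `ℚ_p[[z]][Log z]`. -/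
noncomputable def toLog (M : Matrix (Fin n) (Fin n) ℚ_[p]⟦X⟧) :
    Matrix (Fin n) (Fin n) (Polynomial ℚ_[p]⟦X⟧) :=
  M.map Polynomial.C

/-- `z^N = ∑_j N^j (Log z)^j / j!` for a nilpotent `n × n` matrix `N`; as `N^n = 0`, the sum
stops at `j = n - 1`. -/
noncomputable def zPow (N : Matrix (Fin n) (Fin n) ℚ_[p]) :
    Matrix (Fin n) (Fin n) (Polynomial ℚ_[p]⟦X⟧) :=
  ∑ j ∈ Finset.range n,
    (N ^ j).map fun c => Polynomial.monomial j (PowerSeries.C (c / (j.factorial : ℚ_[p])))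

/-- `Y` is the uniform part of the system `δX = AX` (where `A(0)` is nilpotent):
`Y ∈ GL_n(ℚ_p[[z]])`, `Y(0) = I`, and `Y z^{A(0)}` satisfies `δX = AX`. -/
structure IsUniformPart (A Y : Matrix (Fin n) (Fin n) ℚ_[p]⟦X⟧) : Prop where
  isUnit : IsUnit Y
  eval_zero : evalZero Y = 1
  solution : (toLog Y * zPow (evalZero A)).map logDelta =
    toLog A * (toLog Y * zPow (evalZero A))

/-- `X` is the fundamental matrix of solutions of `δX = AX` (where `A(0)` is nilpotent), that
is, `X = Y z^{A(0)}` with `Y` the uniform part of the system. -/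
def IsFundamentalMatrix (A : Matrix (Fin n) (Fin n) ℚ_[p]⟦X⟧)
    (X : Matrix (Fin n) (Fin n) (Polynomial ℚ_[p]⟦X⟧)) : Prop :=
  ∃ Y, IsUniformPart A Y ∧ X = toLog Y * zPow (evalZero A)

/-- The matrices `A_0 = I`, `A_{j+1} = δ A_j + A_j (A - j I)`. The generic solution of
`δX = AX` at the point `z` is `∑_j A_j / (j! z^j) (x - z)^j`. -/
noncomputable def genericMatrix (A : Matrix (Fin n) (Fin n) ℚ_[p]⟦X⟧) :
    ℕ → Matrix (Fin n) (Fin n) ℚ_[p]⟦X⟧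
  | 0 => 1
  | j + 1 => (genericMatrix A j).map (delta p) +
      genericMatrix A j * (A - (j : ℚ_[p]) • (1 : Matrix (Fin n) (Fin n) ℚ_[p]⟦X⟧))

/-- The radius of convergence `r(L) ∈ [0, ∞]` of `L`, that is, of its generic solution
`∑_j A_j / (j! z^j) (x - z)^j`: `1 / r(L) = limsup ‖A_j / j!‖^{1/j}`
(the factor `z^(-j)` has Gauss norm `1`). -/
noncomputable def MonicDiffOp.radius (L : MonicDiffOp p n) : ℝ≥0∞ :=
  (Filter.limsup (fun j : ℕ =>
    matNorm p ((j.factorial : ℚ_[p])⁻¹ • genericMatrix L.companion j) ^ (1 / (j : ℝ)))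
    Filter.atTop)⁻¹

variable (p)

/-- The Cartier operator `Λ_p (∑ a_i z^i) = ∑ a_{ip} z^i`. -/
noncomputable def cartier (f : ℚ_[p]⟦X⟧) : ℚ_[p]⟦X⟧ :=
  PowerSeries.mk fun i => PowerSeries.coeff (i * p) f

/-- The substitution `M(z) ↦ M(z^{p^m})` on matrices of power series. -/
noncomputable def substFrob (m : ℕ) (M : Matrix (Fin n) (Fin n) ℚ_[p]⟦X⟧) :
    Matrix (Fin n) (Fin n) ℚ_[p]⟦X⟧ :=
  M.map (PowerSeries.expand (p ^ m) (pow_ne_zero m (Fact.out : p.Prime).ne_zero))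

variable {p}

/-- The constant diagonal matrix `diag(1, c, c^2, …, c^{n-1})`. -/
noncomputable def powDiag (n : ℕ) (c : ℚ_[p]) : Matrix (Fin n) (Fin n) ℚ_[p]⟦X⟧ :=
  Matrix.diagonal fun i => PowerSeries.C (c ^ (i : ℕ))

/-- `H_m = Y (Λ_p^m(Y)(z^{p^m}))⁻¹ diag(1, p^m, …, p^{m(n-1)})`. -/
noncomputable def hMatrix (m : ℕ) (Y : Matrix (Fin n) (Fin n) ℚ_[p]⟦X⟧) :
    Matrix (Fin n) (Fin n) ℚ_[p]⟦X⟧ :=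
  Y * (substFrob p m (Y.map ((cartier p)^[m])))⁻¹ * powDiag n ((p : ℚ_[p]) ^ m)

end PadicMUM

open PadicMUM

/-!
The proof needs only one application of the Cartier operator: the matrices `H_m` satisfy the
cocycle relation `H_{m+1}(Y) = H_m(Y) H_1(Y_m)(z^{p^m})`, where
`Y_m = diag(1, p^{-m}, …) Λ_p^m(Y) diag(1, p^m, …)` is the uniform part of the system of `L_m`
(`hMatrix_succ`), so that `L_m`, the integrality of `H_m` and the boundedness of its inverse are
obtained by induction (`exists_iterated_antecedent`).

*The operator `L_1`.* The rows of the fundamental matrix of a companion system are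
`f, δ f, δ² f, …`. As `Λ_p δ = p δ Λ_p`, conjugation of `Λ_p(Y)` by `diag(1, p, …)` restores this
shape, so that `Y_1 z^N` solves a companion system `δ X = B X` with `B(0) = N`
(`companion_antecedentOp`).

*The matrix `H_1`.* For a polynomial `P` let `A_P` be the matrix with `P(δ) X = A_P X` for the
fundamental matrix `X = Y z^N`; the coefficients of `A_P Y` are `Y_k P(k + N)` (`opMat`). If `P` is
integral then so is `A_P`. The integral polynomials `1 - x^{(p-1)p^s}` converge at `x = k + N` to
`1` or `0`, according as `p` divides `k` or not (`tendsto_shiftEval`). Hence the matrices `A_P` of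
these polynomials converge coefficientwise to `F = Λ_p(Y)(z^p) Y⁻¹`, which is therefore integral
(`coeffBound_frobMat`). As `F(0) = 1`, it lies in `GL_n(ℤ_p[[z]])`, and `H_1 = F⁻¹ diag(1, p, …)`.

*The radius of `L_1`.* Let `A_j` and `B_j` be the matrices of the generic solutions of `L` and
`L_1`. Up to multiplication by `F⁻¹` and by constant diagonal matrices, `(B_j / j!)(z^p)` is the
limit of the matrices `A_P` for `P = (1 - x^{(p-1)p^s}) binom(x/p, j)`
(`substFrob_genericMatrix`). In the Newton expansion of such a `P` in the polynomials
`binom(x, i)`, whose matrices are `A_i / i!`, the coefficients of index less than `4pj` are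
integral for large `s`, since `P` takes integral values there; all of them have norm at most
`p^{2j} |i!|`, since `p^j j! P` is integral. So a bound `|A_i / i!| ≤ C q^i` with `q > 1` close to
`1` yields `|B_j / j!| ≤ C' q^{4pj}` (`HasUnitRadius.antecedentMat`).

*The integrality of `L_1`.* The first row of `B_s` is the remainder of the right division of
`δ (δ - 1) ⋯ (δ - s + 1)` by `L_1`. By the radius of convergence, it is integral for some `s ≥ n`.
Hence `L_1` is a right factor of a monic integral operator, and Gauss's lemma for differential
operators with bounded coefficients shows that it is integral (`HasUnitRadius.isIntegral`).
-/

namespace PadicMUM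

variable {p : ℕ} [Fact p.Prime] {n : ℕ}

/-! ### Coefficients of matrices of power series -/

/-- Square matrices of power series over `ℚ_p`. -/
abbrev SeriesMat (p : ℕ) [Fact p.Prime] (n : ℕ) := Matrix (Fin n) (Fin n) ℚ_[p]⟦X⟧

/-- Square matrices over `ℚ_p`. -/
abbrev ConstMat (p : ℕ) [Fact p.Prime] (n : ℕ) := Matrix (Fin n) (Fin n) ℚ_[p]

/-- The coefficient of `z^k` of a matrix of power series. -/
noncomputable def coeffMat (k : ℕ) (M : SeriesMat p n) : ConstMat p n :=
  M.map (PowerSeries.coeff k)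

theorem coeff_delta (k : ℕ) (f : ℚ_[p]⟦X⟧) :
    PowerSeries.coeff k (delta p f) = k * PowerSeries.coeff k f := by
  change PowerSeries.coeff k ((PowerSeries.X : ℚ_[p]⟦X⟧) * PowerSeries.derivative ℚ_[p] f) = _
  cases k with
  | zero => simp
  | succ k =>
    rw [PowerSeries.coeff_succ_X_mul, PowerSeries.coeff_derivative]
    push_cast
    exact mul_comm _ _

theorem seriesMat_ext {M M' : SeriesMat p n} (h : ∀ k, coeffMat k M = coeffMat k M') :
    M = M' := by
  ext i j k
  exact congrFun (congrFun (h k) i) j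

theorem coeffMat_mul (k : ℕ) (M M' : SeriesMat p n) :
    coeffMat k (M * M') =
      ∑ x ∈ Finset.HasAntidiagonal.antidiagonal k, coeffMat x.1 M * coeffMat x.2 M' := by
  ext i j
  simp only [coeffMat, Matrix.map_apply, Matrix.mul_apply, map_sum, PowerSeries.coeff_mul,
    Matrix.sum_apply]
  exact Finset.sum_comm

theorem coeffMat_add (k : ℕ) (M M' : SeriesMat p n) :
    coeffMat k (M + M') = coeffMat k M + coeffMat k M' := by
  ext i j; simp [coeffMat]

theorem coeffMat_smul (k : ℕ) (c : ℚ_[p]) (M : SeriesMat p n) :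
    coeffMat k (c • M) = c • coeffMat k M := by
  ext i j; simp [coeffMat]

theorem coeffMat_delta (k : ℕ) (M : SeriesMat p n) :
    coeffMat k (M.map (delta p)) = (k : ℚ_[p]) • coeffMat k M := by
  ext i j; simp [coeffMat, coeff_delta]

theorem coeffMat_mul_const (k : ℕ) (M : SeriesMat p n) (N : ConstMat p n) :
    coeffMat k (M * N.map PowerSeries.C) = coeffMat k M * N := by
  ext i j; simp [coeffMat, Matrix.mul_apply]

theorem coeffMat_const_mul (k : ℕ) (M : SeriesMat p n) (N : ConstMat p n) :
    coeffMat k (N.map PowerSeries.C * M) = N * coeffMat k M := by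
  ext i j; simp [coeffMat, Matrix.mul_apply]

theorem map_delta_mul (M M' : SeriesMat p n) :
    (M * M').map (delta p) = M.map (delta p) * M' + M * M'.map (delta p) := by
  ext i j : 2
  simp only [Matrix.map_apply, Matrix.mul_apply, Matrix.add_apply, map_sum, Derivation.leibniz,
    smul_eq_mul, ← Finset.sum_add_distrib]
  exact Finset.sum_congr rfl fun x _ => by rw [mul_comm (M' x j), add_comm]

theorem map_delta_const (N : ConstMat p n) : (N.map PowerSeries.C).map (delta p) = 0 := by
  ext i j k
  simp only [Matrix.map_apply, coeff_delta, PowerSeries.coeff_C, Matrix.zero_apply, map_zero]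
  split_ifs with h <;> simp [h]

theorem isUnit_of_evalZero_eq_one {M : SeriesMat p n} (h : evalZero M = 1) : IsUnit M := by
  rw [Matrix.isUnit_iff_isUnit_det, PowerSeries.isUnit_iff_constantCoeff, RingHom.map_det]
  have : (PowerSeries.constantCoeff (R := ℚ_[p])).mapMatrix M = 1 := h
  rw [this]; simp

theorem evalZero_mul (M M' : SeriesMat p n) :
    evalZero (M * M') = evalZero M * evalZero M' := by
  simp [evalZero, Matrix.map_mul]

theorem evalZero_eq_coeffMat (M : SeriesMat p n) : evalZero M = coeffMat 0 M := by
  ext i j; simp [evalZero, coeffMat]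

/-! ### Bounds for the coefficients -/

/-- All coefficients of all entries of `M` have norm at most `c`. -/
def CoeffBound (c : ℝ) (M : SeriesMat p n) : Prop :=
  ∀ i j k, ‖PowerSeries.coeff k (M i j)‖ ≤ c

theorem matNorm_le_ofReal_iff {c : ℝ} (hc : 0 ≤ c) {M : SeriesMat p n} :
    matNorm p M ≤ ENNReal.ofReal c ↔ CoeffBound c M := by
  simp only [matNorm, gaussNorm, iSup_le_iff, ← ofReal_norm, ENNReal.ofReal_le_ofReal_iff hc]
  rfl

theorem mem_integralSeries_iff (f : ℚ_[p]⟦X⟧) :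
    f ∈ integralSeries p ↔ ∀ k, ‖PowerSeries.coeff k f‖ ≤ 1 := by
  constructor
  · rintro ⟨g, rfl⟩ k
    rw [PowerSeries.coeff_map]
    exact PadicInt.norm_le_one _
  · intro h
    let a : ℕ → ℤ_[p] := fun k => ⟨_, h k⟩
    refine ⟨PowerSeries.mk a, ?_⟩
    ext k
    rw [PowerSeries.coeff_map, PowerSeries.coeff_mk]
    rfl

theorem coeffBound_one_iff {M : SeriesMat p n} :
    CoeffBound 1 M ↔ ∀ i j, M i j ∈ integralSeries p := by
  simp only [mem_integralSeries_iff, CoeffBound]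

theorem mem_boundedSeries_iff (f : ℚ_[p]⟦X⟧) :
    f ∈ boundedSeries p ↔ ∃ C : ℝ, ∀ k, ‖PowerSeries.coeff k f‖ ≤ C :=
  gaussNorm_ne_top_iff p f

namespace CoeffBound

variable {c d : ℝ} {M M' : SeriesMat p n}

theorem mono (h : CoeffBound c M) (hcd : c ≤ d) : CoeffBound d M :=
  fun i j k => (h i j k).trans hcd

theorem add (h : CoeffBound c M) (h' : CoeffBound c M') : CoeffBound c (M + M') := by
  intro i j k
  rw [Matrix.add_apply, map_add]
  exact (IsUltrametricDist.norm_add_le_max _ _).trans (max_le (h i j k) (h' i j k))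

theorem zero (hc : 0 ≤ c) : CoeffBound c (0 : SeriesMat p n) := by
  intro i j k; simpa using hc

theorem sum {ι : Type*} (hc : 0 ≤ c) (s : Finset ι) {f : ι → SeriesMat p n}
    (h : ∀ x ∈ s, CoeffBound c (f x)) : CoeffBound c (∑ x ∈ s, f x) :=
  Finset.sum_induction f (CoeffBound c) (fun _ _ h h' => h.add h') (zero hc) h

theorem smul (a : ℚ_[p]) (h : CoeffBound c M) : CoeffBound (‖a‖ * c) (a • M) := by
  intro i j k
  rw [Matrix.smul_apply, PowerSeries.coeff_smul, smul_eq_mul, norm_mul]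
  exact mul_le_mul_of_nonneg_left (h i j k) (norm_nonneg _)

theorem delta (h : CoeffBound c M) : CoeffBound c (M.map (delta p)) := by
  intro i j k
  rw [Matrix.map_apply, coeff_delta, norm_mul]
  refine le_trans ?_ (h i j k)
  exact mul_le_of_le_one_left (norm_nonneg _)
    (by simpa using Padic.norm_int_le_one (p := p) (k : ℤ))

theorem mul (hc : 0 ≤ c) (hd : 0 ≤ d) (h : CoeffBound c M) (h' : CoeffBound d M') :
    CoeffBound (c * d) (M * M') := by
  intro i j k
  rw [Matrix.mul_apply, map_sum]
  refine IsUltrametricDist.norm_sum_le_of_forall_le_of_nonneg (mul_nonneg hc hd) fun x _ => ?_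
  rw [PowerSeries.coeff_mul]
  refine IsUltrametricDist.norm_sum_le_of_forall_le_of_nonneg (mul_nonneg hc hd) fun y _ => ?_
  rw [norm_mul]
  exact mul_le_mul (h _ _ _) (h' _ _ _) (norm_nonneg _) hc

theorem mul_integral (h : CoeffBound 1 M) (h' : CoeffBound 1 M') : CoeffBound 1 (M * M') := by
  simpa using h.mul zero_le_one zero_le_one h'

theorem one : CoeffBound 1 (1 : SeriesMat p n) := by
  rw [coeffBound_one_iff]
  intro i j
  rw [Matrix.one_apply]
  split_ifs
  exacts [one_mem _, zero_mem _]

/-- A matrix over `ℤ_p[[z]]` whose value at `0` is the identity is invertible over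
`ℤ_p[[z]]`. -/
theorem inv (h : CoeffBound 1 M) (h0 : evalZero M = 1) : CoeffBound 1 M⁻¹ := by
  rw [coeffBound_one_iff] at h
  choose g hg using h
  let φ : ℤ_[p]⟦X⟧ →+* ℚ_[p]⟦X⟧ := PowerSeries.map (algebraMap ℤ_[p] ℚ_[p])
  let G : Matrix (Fin n) (Fin n) ℤ_[p]⟦X⟧ := Matrix.of g
  have hGM : φ.mapMatrix G = M := by
    apply Matrix.ext
    exact hg
  have hdet : IsUnit G.det := by
    have h1 : φ G.det = M.det := by rw [RingHom.map_det, hGM]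
    have h2 : PowerSeries.constantCoeff M.det = 1 := by
      rw [RingHom.map_det]
      have : (PowerSeries.constantCoeff (R := ℚ_[p])).mapMatrix M = 1 := h0
      rw [this]; simp
    rw [← h1] at h2
    have h3 : algebraMap ℤ_[p] ℚ_[p] (PowerSeries.constantCoeff G.det) = 1 := by
      rw [← h2]
      simp only [φ, ← PowerSeries.coeff_zero_eq_constantCoeff_apply, PowerSeries.coeff_map]
    rw [PowerSeries.isUnit_iff_constantCoeff]
    have h4 : PowerSeries.constantCoeff G.det = 1 := by
      apply FaithfulSMul.algebraMap_injective ℤ_[p] ℚ_[p]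
      rw [h3, map_one]
    rw [h4]; exact isUnit_one
  have hinv : M⁻¹ = φ.mapMatrix G⁻¹ := by
    apply Matrix.inv_eq_right_inv
    rw [← hGM, ← map_mul, Matrix.mul_nonsing_inv _ hdet, map_one]
  rw [hinv, coeffBound_one_iff]
  intro i j
  exact ⟨G⁻¹ i j, rfl⟩

end CoeffBound

/-! ### Polynomials in `δ` acting on the solutions of a system -/

/-- The matrix of power series `∑_k Y_k g_k z^k`, where `Y = ∑_k Y_k z^k`. -/
noncomputable def coeffTwist (Y : SeriesMat p n) (g : ℕ → ConstMat p n) : SeriesMat p n :=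
  Matrix.of fun i j => PowerSeries.mk fun k => (coeffMat k Y * g k) i j

theorem coeffMat_coeffTwist (Y : SeriesMat p n) (g : ℕ → ConstMat p n) (k : ℕ) :
    coeffMat k (coeffTwist Y g) = coeffMat k Y * g k := by
  ext i j; simp [coeffMat, coeffTwist]

/-- The value `P(k + N)` of a polynomial `P`. As `δ` acts on `W z^k z^N` as `k + N` acts on the
right of `W`, so does `P(δ)` act as `P(k + N)`. -/
noncomputable def shiftEval (N : ConstMat p n) (P : Polynomial ℚ_[p]) (k : ℕ) : ConstMat p n :=
  Polynomial.aeval ((k : ℚ_[p]) • (1 : ConstMat p n) + N) P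

/-- The matrix `A_P` such that `P(δ) X = A_P X` for the fundamental matrix `X = Y z^N` of a system
`δ X = A X`. -/
noncomputable def opMat (N : ConstMat p n) (Y : SeriesMat p n) (P : Polynomial ℚ_[p]) :
    SeriesMat p n :=
  coeffTwist Y (shiftEval N P) * Y⁻¹

/-- The system `δ X = A X` for `X = Y z^N`, after division by `z^N` on the right. -/
structure IsLogFreeSolution (A : SeriesMat p n) (N : ConstMat p n) (Y : SeriesMat p n) :
    Prop where
  isUnit : IsUnit Y
  delta_eq : Y.map (delta p) + Y * N.map PowerSeries.C = A * Y

theorem mul_inv_of_isUnit {Y : SeriesMat p n} (h : IsUnit Y) : Y * Y⁻¹ = 1 :=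
  Matrix.mul_nonsing_inv _ ((Matrix.isUnit_iff_isUnit_det _).1 h)

theorem inv_mul_of_isUnit {Y : SeriesMat p n} (h : IsUnit Y) : Y⁻¹ * Y = 1 :=
  Matrix.nonsing_inv_mul _ ((Matrix.isUnit_iff_isUnit_det _).1 h)

section opMat

variable {A Y : SeriesMat p n} {N : ConstMat p n}

theorem opMat_mul_self (h : IsUnit Y) (P : Polynomial ℚ_[p]) :
    opMat N Y P * Y = coeffTwist Y (shiftEval N P) := by
  rw [opMat, mul_assoc, inv_mul_of_isUnit h, mul_one]

theorem opMat_one (h : IsUnit Y) : opMat N Y 1 = 1 := by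
  rw [opMat]
  have : coeffTwist Y (shiftEval N 1) = Y := by
    refine seriesMat_ext fun k => ?_
    rw [coeffMat_coeffTwist, shiftEval, map_one, mul_one]
  rw [this, mul_inv_of_isUnit h]

theorem opMat_add (P Q : Polynomial ℚ_[p]) :
    opMat N Y (P + Q) = opMat N Y P + opMat N Y Q := by
  rw [opMat, opMat, opMat, ← add_mul]
  congr 1
  refine seriesMat_ext fun k => ?_
  simp only [coeffMat_add, coeffMat_coeffTwist, shiftEval, map_add, mul_add]

theorem opMat_smul (c : ℚ_[p]) (P : Polynomial ℚ_[p]) :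
    opMat N Y (c • P) = c • opMat N Y P := by
  rw [opMat, opMat, ← smul_mul_assoc]
  congr 1
  refine seriesMat_ext fun k => ?_
  simp only [coeffMat_smul, coeffMat_coeffTwist, shiftEval, map_smul, Matrix.mul_smul]

theorem opMat_sum {ι : Type*} (s : Finset ι) (f : ι → Polynomial ℚ_[p]) :
    opMat N Y (∑ x ∈ s, f x) = ∑ x ∈ s, opMat N Y (f x) := by
  classical
  induction s using Finset.induction_on with
  | empty =>
    have := opMat_smul (N := N) (Y := Y) 0 0
    simpa using this
  | insert a s ha ih => rw [Finset.sum_insert ha, Finset.sum_insert ha, opMat_add, ih]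

theorem opMat_mul_X (h : IsLogFreeSolution A N Y) (P : Polynomial ℚ_[p]) :
    opMat N Y (P * Polynomial.X) = (opMat N Y P).map (delta p) + opMat N Y P * A := by
  have h1 : coeffTwist Y (shiftEval N (P * Polynomial.X)) =
      (coeffTwist Y (shiftEval N P)).map (delta p) +
        coeffTwist Y (shiftEval N P) * N.map PowerSeries.C := by
    refine seriesMat_ext fun k => ?_
    simp only [coeffMat_add, coeffMat_mul_const, coeffMat_delta, coeffMat_coeffTwist, shiftEval,
      map_mul, Polynomial.aeval_X, mul_add, mul_smul_comm, mul_one, mul_assoc]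
  rw [opMat, h1, ← opMat_mul_self h.isUnit, map_delta_mul, mul_assoc (opMat N Y P) Y, add_assoc,
    ← mul_add, h.delta_eq, add_mul, mul_assoc, mul_assoc, mul_assoc, mul_inv_of_isUnit h.isUnit,
    mul_one, mul_one]

theorem opMat_mul_X_sub (h : IsLogFreeSolution A N Y) (P : Polynomial ℚ_[p]) (c : ℚ_[p]) :
    opMat N Y (P * (Polynomial.X - Polynomial.C c)) =
      (opMat N Y P).map (delta p) + opMat N Y P * (A - c • (1 : SeriesMat p n)) := by
  have : P * (Polynomial.X - Polynomial.C c) = P * Polynomial.X + (-c) • P := by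
    rw [Polynomial.smul_eq_C_mul, Polynomial.C_neg]; ring
  rw [this, opMat_add, opMat_smul, opMat_mul_X h, mul_sub, mul_smul_comm, mul_one, neg_smul]
  abel

theorem opMat_descPochhammer (h : IsLogFreeSolution A N Y) (j : ℕ) :
    opMat N Y (descPochhammer ℚ_[p] j) = genericMatrix A j := by
  induction j with
  | zero => rw [descPochhammer_zero, opMat_one h.isUnit]; rfl
  | succ j ih =>
    rw [descPochhammer_succ_right, ← Polynomial.C_eq_natCast, opMat_mul_X_sub h, ih]; rfl

/-- Integral polynomials in `δ` act on the solutions of a system over `ℤ_p[[z]]` by matrices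
over `ℤ_p[[z]]`. -/
theorem coeffBound_opMat (h : IsLogFreeSolution A N Y) (hA : CoeffBound 1 A)
    (P : Polynomial ℤ) : CoeffBound 1 (opMat N Y (P.map (Int.castRingHom ℚ_[p]))) := by
  induction P using Polynomial.induction_on' with
  | add P Q hP hQ => rw [Polynomial.map_add, opMat_add]; exact hP.add hQ
  | monomial k a =>
    have hX : CoeffBound 1 (opMat N Y (Polynomial.X ^ k)) := by
      induction k with
      | zero => rw [pow_zero, opMat_one h.isUnit]; exact CoeffBound.one
      | succ k ih => rw [pow_succ, opMat_mul_X h]; exact ih.delta.add (ih.mul_integral hA)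
    rw [Polynomial.map_monomial, ← Polynomial.smul_X_eq_monomial, opMat_smul]
    refine (hX.smul _).mono ?_
    rw [mul_one]
    exact Padic.norm_int_le_one a

theorem coeffBound_genericMatrix (h : CoeffBound 1 A) (j : ℕ) :
    CoeffBound 1 (genericMatrix A j) := by
  induction j with
  | zero => exact CoeffBound.one
  | succ j ih =>
    refine ih.delta.add (ih.mul_integral ?_)
    rw [sub_eq_add_neg, ← neg_smul]
    refine h.add ((CoeffBound.one.smul _).mono ?_)
    rw [mul_one, norm_neg]
    simpa using Padic.norm_int_le_one (p := p) (j : ℤ)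

/-- A coefficientwise limit of matrices `A_P` obeys the same bound. -/
theorem coeffBound_of_tendsto {c : ℝ} {g : ℕ → ConstMat p n} {P : ℕ → Polynomial ℚ_[p]}
    (hlim : ∀ k, Filter.Tendsto (fun s => shiftEval N (P s) k) Filter.atTop (nhds (g k)))
    (hb : ∀ᶠ s in Filter.atTop, CoeffBound c (opMat N Y (P s))) :
    CoeffBound c (coeffTwist Y g * Y⁻¹) := by
  intro i j k
  have hcont : Filter.Tendsto (fun s => coeffMat k (opMat N Y (P s))) Filter.atTop
      (nhds (coeffMat k (coeffTwist Y g * Y⁻¹))) := by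
    simp only [opMat, coeffMat_mul, coeffMat_coeffTwist]
    exact tendsto_finsetSum _ fun x _ => ((hlim x.1).const_mul _).mul_const _
  have hent : Filter.Tendsto (fun s => PowerSeries.coeff k (opMat N Y (P s) i j)) Filter.atTop
      (nhds (PowerSeries.coeff k ((coeffTwist Y g * Y⁻¹) i j))) :=
    ((continuous_apply j).tendsto _).comp (((continuous_apply i).tendsto _).comp hcont)
  exact le_of_tendsto hent.norm (hb.mono fun s hs => hs i j k)

end opMat

/-! ### The `p`-adic approximation of the characteristic function of `pℤ_p` -/

/-- `x ^ ((p-1) p^s)` tends to `0` or `1`, according as `p` divides `x` or not. -/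
theorem tendsto_natCast_pow (k : ℕ) :
    Filter.Tendsto (fun s => (k : ℚ_[p]) ^ ((p - 1) * p ^ s)) Filter.atTop
      (nhds (if p ∣ k then 0 else 1)) := by
  have hp : p.Prime := Fact.out
  split_ifs with h
  · have h1 : ‖(k : ℚ_[p])‖ < 1 := (Padic.norm_natCast_lt_one_iff).2 h
    refine (tendsto_pow_atTop_nhds_zero_of_norm_lt_one h1).comp ?_
    exact Filter.Tendsto.const_mul_atTop' (Nat.sub_pos_of_lt hp.one_lt)
      (tendsto_pow_atTop_atTop_of_one_lt hp.one_lt)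
  · rw [tendsto_iff_norm_sub_tendsto_zero]
    have hb : ∀ s, ‖(k : ℚ_[p]) ^ ((p - 1) * p ^ s) - 1‖ ≤ ((p : ℝ)⁻¹) ^ s := by
      intro s
      have hc : Nat.Coprime k (p ^ (s + 1)) :=
        ((Nat.Prime.coprime_iff_not_dvd hp).2 h).symm.pow_right _
      have h2 : k ^ ((p - 1) * p ^ s) ≡ 1 [MOD p ^ (s + 1)] := by
        have := Nat.ModEq.pow_totient hc
        rwa [Nat.totient_prime_pow_succ hp, mul_comm] at this
      have h3 : ((p ^ (s + 1) : ℕ) : ℤ) ∣ (k : ℤ) ^ ((p - 1) * p ^ s) - 1 := by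
        have := (Nat.modEq_iff_dvd.1 h2.symm)
        push_cast at this ⊢
        exact this
      have h4 := (Padic.norm_int_le_pow_iff_dvd (p := p) _ _).2 h3
      push_cast at h4
      refine h4.trans ?_
      rw [zpow_neg, ← inv_zpow, ← Nat.cast_succ, zpow_natCast, Nat.succ_eq_add_one]
      exact pow_le_pow_of_le_one (by positivity)
        (inv_le_one_of_one_le₀ (by exact_mod_cast hp.one_le)) (Nat.le_succ s)
    refine squeeze_zero (fun _ => norm_nonneg _) hb ?_
    exact tendsto_pow_atTop_nhds_zero_of_lt_one (by positivity)
      (inv_lt_one_of_one_lt₀ (by exact_mod_cast hp.one_lt))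

theorem tendsto_choose {l : ℕ} (hl : l ≠ 0) :
    Filter.Tendsto (fun s => ((((p - 1) * p ^ s).choose l : ℕ) : ℚ_[p])) Filter.atTop
      (nhds 0) := by
  have hp : p.Prime := Fact.out
  obtain ⟨l, rfl⟩ := Nat.exists_eq_succ_of_ne_zero hl
  rw [tendsto_zero_iff_norm_tendsto_zero]
  have hl0 : ((l + 1 : ℕ) : ℚ_[p]) ≠ 0 := by exact_mod_cast hl
  have hb : ∀ s, ‖((((p - 1) * p ^ s).choose (l + 1) : ℕ) : ℚ_[p])‖ ≤
      ‖((l + 1 : ℕ) : ℚ_[p])‖⁻¹ * ((p : ℝ)⁻¹) ^ s := by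
    intro s
    have hM : 0 < (p - 1) * p ^ s :=
      Nat.mul_pos (Nat.sub_pos_of_lt hp.one_lt) (pow_pos hp.pos s)
    obtain ⟨M, hM'⟩ := Nat.exists_eq_succ_of_ne_zero hM.ne'
    have h1 : ((p - 1) * p ^ s) * M.choose l = ((p - 1) * p ^ s).choose (l + 1) * (l + 1) := by
      rw [hM']; exact Nat.add_one_mul_choose_eq M l
    have h2 := congrArg (fun x : ℕ => ‖(x : ℚ_[p])‖) h1
    simp only [Nat.cast_mul, norm_mul, Nat.cast_pow, norm_pow, Padic.norm_p] at h2
    rw [inv_mul_eq_div, le_div_iff₀ (norm_pos_iff.2 hl0), ← h2]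
    have ha : ∀ a : ℕ, ‖(a : ℚ_[p])‖ ≤ 1 := fun a => by
      simpa using Padic.norm_int_le_one (p := p) (a : ℤ)
    have h3 : (0 : ℝ) ≤ ((p : ℝ)⁻¹) ^ s := by positivity
    calc ‖((p - 1 : ℕ) : ℚ_[p])‖ * ((p : ℝ)⁻¹) ^ s * ‖(M.choose l : ℚ_[p])‖
        ≤ 1 * ((p : ℝ)⁻¹) ^ s * 1 := by
          gcongr
          · exact ha _
          · exact ha _
      _ = _ := by ring
  refine squeeze_zero (fun _ => norm_nonneg _) hb ?_
  rw [← mul_zero ‖((l + 1 : ℕ) : ℚ_[p])‖⁻¹]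
  exact (tendsto_pow_atTop_nhds_zero_of_lt_one (by positivity)
    (inv_lt_one_of_one_lt₀ (by exact_mod_cast hp.one_lt))).const_mul _

/-- `1 - x ^ ((p-1) p^s)` approximates the characteristic function of `pℤ_p`, even at arguments
`k + N` with a nilpotent part. -/
theorem tendsto_shiftEval {N : ConstMat p n} {e : ℕ} (hN : N ^ e = 0) (k : ℕ) :
    Filter.Tendsto
      (fun s => shiftEval N (1 - Polynomial.X ^ ((p - 1) * p ^ s)) k) Filter.atTop
      (nhds (if p ∣ k then 1 else 0)) := by
  have hexp : ∀ M : ℕ, ((k : ℚ_[p]) • (1 : ConstMat p n) + N) ^ M =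
      ∑ l ∈ Finset.range (e + 1), ((k : ℚ_[p]) ^ (M - l) * (M.choose l : ℚ_[p])) • N ^ l := by
    intro M
    have hc : Commute N ((k : ℚ_[p]) • (1 : ConstMat p n)) := (Commute.one_right N).smul_right _
    rw [add_comm, hc.add_pow]
    have hterm : ∀ l, N ^ l * ((k : ℚ_[p]) • (1 : ConstMat p n)) ^ (M - l) *
        ((M.choose l : ℕ) : ConstMat p n) =
        ((k : ℚ_[p]) ^ (M - l) * (M.choose l : ℚ_[p])) • N ^ l := by
      intro l
      have : ((M.choose l : ℕ) : ConstMat p n) = ((M.choose l : ℕ) : ℚ_[p]) • 1 := by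
        rw [← nsmul_one, ← Nat.cast_smul_eq_nsmul ℚ_[p]]
      rw [this, smul_pow, one_pow, mul_smul_comm, mul_smul_comm, mul_one, mul_one, smul_smul,
        mul_comm]
    simp only [hterm]
    -- terms beyond `M` vanish through the binomial coefficient, terms beyond `e` through `N ^ l`
    have h1 : ∀ l, M < l → ((k : ℚ_[p]) ^ (M - l) * (M.choose l : ℚ_[p])) • N ^ l = 0 := by
      intro l hl
      rw [Nat.choose_eq_zero_of_lt hl]; simp
    have h2 : ∀ l, e < l → ((k : ℚ_[p]) ^ (M - l) * (M.choose l : ℚ_[p])) • N ^ l = 0 := by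
      intro l hl
      rw [pow_eq_zero_of_le hl.le hN, smul_zero]
    rcases le_total e M with hle | hle
    · refine (Finset.sum_subset (Finset.range_mono (by omega)) fun l _ hl => h2 l ?_).symm
      simpa [Nat.lt_succ_iff] using hl
    · refine Finset.sum_subset (Finset.range_mono (by omega)) fun l _ hl => h1 l ?_
      simpa [Nat.lt_succ_iff] using hl
  have hpow : Filter.Tendsto
      (fun s => ((k : ℚ_[p]) • (1 : ConstMat p n) + N) ^ ((p - 1) * p ^ s)) Filter.atTop
      (nhds (if p ∣ k then 0 else 1)) := by
    simp only [hexp, Finset.sum_range_succ']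
    have h0 : Filter.Tendsto (fun s => ∑ l ∈ Finset.range e,
        ((k : ℚ_[p]) ^ ((p - 1) * p ^ s - (l + 1)) *
          (((p - 1) * p ^ s).choose (l + 1) : ℚ_[p])) • N ^ (l + 1)) Filter.atTop (nhds 0) := by
      rw [← Finset.sum_const_zero (s := Finset.range e) (M := ConstMat p n)]
      refine tendsto_finsetSum _ fun l _ => ?_
      rw [← zero_smul ℚ_[p] (N ^ (l + 1))]
      refine Filter.Tendsto.smul_const ?_ _
      refine squeeze_zero_norm (fun s => ?_)
        (tendsto_zero_iff_norm_tendsto_zero.1 (tendsto_choose (p := p) (Nat.succ_ne_zero l)))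
      rw [norm_mul, norm_pow]
      refine mul_le_of_le_one_left (norm_nonneg _) (pow_le_one₀ (norm_nonneg _) ?_)
      simpa using Padic.norm_int_le_one (p := p) (k : ℤ)
    have h1 := (tendsto_natCast_pow (p := p) k).smul_const (1 : ConstMat p n)
    have h2 := h0.add h1
    rw [zero_add] at h2
    convert h2 using 2
    · simp
    · split_ifs <;> simp
  have := hpow.const_sub 1
  convert this using 2
  · simp [shiftEval]
  · split_ifs <;> simp

/-! ### The fundamental matrix without logarithms -/

/-- The nilpotent matrix with ones on the superdiagonal and zeros elsewhere, which is the value at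
`0` of the companion matrix of every MUM operator. -/
noncomputable def shiftMat (p : ℕ) [Fact p.Prime] (n : ℕ) : ConstMat p n :=
  Matrix.of fun i j => if (j : ℕ) = i + 1 then 1 else 0

theorem evalZero_companion {L : MonicDiffOp p n} (h : L.IsMUM) :
    evalZero L.companion = shiftMat p n := by
  ext i j
  simp only [evalZero, MonicDiffOp.companion, shiftMat, Matrix.map_apply, Matrix.of_apply]
  split_ifs with h1 h2 h2
  · exact absurd j.2 (by omega)
  · rw [map_neg, h j, neg_zero]
  · simp
  · simp

theorem shiftMat_pow_apply (k : ℕ) (i j : Fin n) :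
    (shiftMat p n ^ k) i j = if (j : ℕ) = i + k then 1 else 0 := by
  induction k generalizing j with
  | zero => simp [Matrix.one_apply, Fin.ext_iff, eq_comm]
  | succ k ih =>
    rw [pow_succ, Matrix.mul_apply]
    have hx : ∀ x : Fin n, (shiftMat p n ^ k) i x * shiftMat p n x j =
        if (x : ℕ) = i + k ∧ (j : ℕ) = x + 1 then 1 else 0 := by
      intro x
      rw [ih, shiftMat, Matrix.of_apply, ite_and]
      simp only [ite_mul, one_mul, zero_mul]
    simp only [hx]
    split_ifs with h
    · have hlt : (i : ℕ) + k < n := by have := j.2; omega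
      rw [Finset.sum_eq_single (⟨i + k, hlt⟩ : Fin n)]
      · exact if_pos ⟨rfl, by simp only; omega⟩
      · exact fun b _ hb => if_neg fun h' => hb (Fin.ext h'.1)
      · simp
    · exact Finset.sum_eq_zero fun x _ => if_neg fun h' => h (by omega)

theorem shiftMat_pow_self : shiftMat p n ^ n = 0 := by
  ext i j
  rw [shiftMat_pow_apply, if_neg (by omega), Matrix.zero_apply]

theorem coeff_toLog_mul_zPow {N : ConstMat p n} (hN : N ^ n = 0) (Y : SeriesMat p n) (k : ℕ)
    (i j : Fin n) :
    ((toLog Y * zPow N) i j).coeff k =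
      (Y * ((k.factorial : ℚ_[p])⁻¹ • N ^ k).map PowerSeries.C) i j := by
  have h1 : ∀ x, (zPow N x j).coeff k =
      PowerSeries.C (((k.factorial : ℚ_[p])⁻¹ • N ^ k) x j) := by
    intro x
    rw [zPow, Matrix.sum_apply, Polynomial.finsetSum_coeff]
    simp only [Matrix.map_apply, Polynomial.coeff_monomial]
    rw [Finset.sum_ite_eq']
    split_ifs with h
    · rw [Matrix.smul_apply, smul_eq_mul, div_eq_inv_mul]
    · rw [pow_eq_zero_of_le (by simpa using h) hN]; simp
  rw [Matrix.mul_apply, Polynomial.finsetSum_coeff, Matrix.mul_apply]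
  refine Finset.sum_congr rfl fun x _ => ?_
  rw [toLog, Matrix.map_apply, Polynomial.coeff_C_mul, h1, Matrix.map_apply]

theorem coeff_logDelta (P : Polynomial ℚ_[p]⟦X⟧) (k : ℕ) :
    (logDelta P).coeff k = delta p (P.coeff k) + P.coeff (k + 1) * (k + 1) := by
  rw [logDelta, Polynomial.coeff_add, Polynomial.coeff_derivative, Polynomial.sum_def,
    Polynomial.finsetSum_coeff]
  simp only [Polynomial.coeff_monomial]
  rw [Finset.sum_ite_eq']
  split_ifs with h
  · rfl
  · rw [Polynomial.notMem_support_iff.1 h, map_zero]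

theorem map_C_mul (M N : ConstMat p n) :
    (M * N).map (PowerSeries.C (R := ℚ_[p])) = M.map PowerSeries.C * N.map PowerSeries.C :=
  Matrix.map_mul

theorem toLog_mul (A Y : SeriesMat p n) : toLog (A * Y) = toLog A * toLog Y :=
  Matrix.map_mul

/-- The coefficients of the powers of `Log z` in `δ X = A X` all follow from that of
`(Log z)^0`. -/
theorem isUniformPart_iff {A Y : SeriesMat p n} {N : ConstMat p n} (hA : evalZero A = N)
    (hN : N ^ n = 0) :
    IsUniformPart A Y ↔ IsLogFreeSolution A N Y ∧ evalZero Y = 1 := by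
  have hl : ∀ k i j, ((toLog Y * zPow N).map logDelta i j).coeff k =
      ((Y.map (delta p) + Y * N.map PowerSeries.C) *
        ((k.factorial : ℚ_[p])⁻¹ • N ^ k).map PowerSeries.C) i j := by
    intro k i j
    rw [Matrix.map_apply, coeff_logDelta, coeff_toLog_mul_zPow hN, coeff_toLog_mul_zPow hN,
      add_mul, mul_assoc, ← map_C_mul, mul_smul_comm, ← pow_succ', Matrix.add_apply]
    congr 1
    · rw [← Matrix.map_apply (f := delta p), map_delta_mul, map_delta_const, mul_zero, add_zero]
    · have : ((k.factorial : ℚ_[p])⁻¹ • N ^ (k + 1)) =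
          ((k + 1 : ℕ) : ℚ_[p]) • (((k + 1).factorial : ℚ_[p])⁻¹ • N ^ (k + 1)) := by
        rw [smul_smul, Nat.factorial_succ, Nat.cast_mul, mul_inv, ← mul_assoc,
          mul_inv_cancel₀ (by exact_mod_cast Nat.succ_ne_zero k), one_mul]
      rw [this]
      simp only [Matrix.mul_apply, Finset.sum_mul, Matrix.map_apply, Matrix.smul_apply]
      refine Finset.sum_congr rfl fun x _ => ?_
      simp only [smul_eq_mul, map_mul, map_natCast, Nat.cast_add, Nat.cast_one, map_add, map_one]
      ring
  have hr : ∀ k i j, ((toLog A * (toLog Y * zPow N)) i j).coeff k =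
      ((A * Y) * ((k.factorial : ℚ_[p])⁻¹ • N ^ k).map PowerSeries.C) i j := by
    intro k i j
    rw [← coeff_toLog_mul_zPow hN, ← mul_assoc, toLog_mul]
  constructor
  · intro h
    refine ⟨⟨h.isUnit, ?_⟩, h.eval_zero⟩
    have hs := h.solution
    rw [hA] at hs
    refine Matrix.ext fun i j => ?_
    have h1 := congrArg (fun M => Polynomial.coeff (M i j) 0) hs
    simp only [hl, hr] at h1
    have h2 : (((Nat.factorial 0 : ℕ) : ℚ_[p])⁻¹ • N ^ 0).map PowerSeries.C =
        (1 : SeriesMat p n) := by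
      simp
    rwa [h2, mul_one, mul_one] at h1
  · rintro ⟨h, h0⟩
    refine ⟨h.isUnit, h0, ?_⟩
    rw [hA]
    ext i j k : 3
    rw [hl, hr, h.delta_eq]

/-! ### Diagonal matrices, the Cartier operator and the Frobenius substitution -/

/-- The matrix `powDiag n c` over `ℚ_p`. -/
noncomputable def constPowDiag (n : ℕ) (c : ℚ_[p]) : ConstMat p n :=
  Matrix.diagonal fun i => c ^ (i : ℕ)

theorem powDiag_eq_map (c : ℚ_[p]) : powDiag n c = (constPowDiag n c).map PowerSeries.C := by
  rw [powDiag, constPowDiag, Matrix.diagonal_map (map_zero _)]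

theorem constPowDiag_mul (c d : ℚ_[p]) :
    constPowDiag n c * constPowDiag n d = constPowDiag n (c * d) := by
  simp [constPowDiag, Matrix.diagonal_mul_diagonal, mul_pow]

theorem constPowDiag_one : constPowDiag n (1 : ℚ_[p]) = 1 := by
  simp [constPowDiag]

theorem constPowDiag_inv_mul {c : ℚ_[p]} (hc : c ≠ 0) :
    constPowDiag n c⁻¹ * constPowDiag n c = 1 := by
  rw [constPowDiag_mul, inv_mul_cancel₀ hc, constPowDiag_one]

theorem powDiag_mul (c d : ℚ_[p]) : powDiag n c * powDiag n d = powDiag n (c * d) := by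
  rw [powDiag_eq_map, powDiag_eq_map, powDiag_eq_map, ← map_C_mul, constPowDiag_mul]

theorem powDiag_one : powDiag n (1 : ℚ_[p]) = 1 := by
  simp [powDiag]

theorem powDiag_mul_inv {c : ℚ_[p]} (hc : c ≠ 0) : powDiag n c * powDiag n c⁻¹ = 1 := by
  rw [powDiag_mul, mul_inv_cancel₀ hc, powDiag_one]

theorem powDiag_inv_mul {c : ℚ_[p]} (hc : c ≠ 0) : powDiag n c⁻¹ * powDiag n c = 1 := by
  rw [powDiag_mul, inv_mul_cancel₀ hc, powDiag_one]

theorem shiftMat_mul_constPowDiag (c : ℚ_[p]) :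
    shiftMat p n * constPowDiag n c = c • (constPowDiag n c * shiftMat p n) := by
  ext i j
  rw [constPowDiag, Matrix.mul_diagonal, Matrix.smul_apply, Matrix.diagonal_mul]
  simp only [shiftMat, Matrix.of_apply]
  split_ifs with h
  · rw [h, pow_succ, smul_eq_mul]; ring
  · simp

theorem coeffMat_cartier (k : ℕ) (M : SeriesMat p n) :
    coeffMat k (M.map (cartier p)) = coeffMat (k * p) M := by
  ext i j; simp [coeffMat, cartier]

theorem coeffMat_substFrob_mul (m k : ℕ) (M : SeriesMat p n) :
    coeffMat (p ^ m * k) (substFrob p m M) = coeffMat k M := by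
  ext i j; simp [coeffMat, substFrob]

theorem coeffMat_substFrob_of_not_dvd (m k : ℕ) (M : SeriesMat p n) (h : ¬ p ^ m ∣ k) :
    coeffMat k (substFrob p m M) = 0 := by
  ext i j
  simp [coeffMat, substFrob, PowerSeries.coeff_expand_of_not_dvd _ _ _ h]

theorem substFrob_mul (m : ℕ) (M M' : SeriesMat p n) :
    substFrob p m (M * M') = substFrob p m M * substFrob p m M' := by
  rw [substFrob, substFrob, substFrob, Matrix.map_mul]

theorem substFrob_one (m : ℕ) : substFrob p m (1 : SeriesMat p n) = 1 := by
  rw [substFrob, Matrix.map_one _ (map_zero _) (map_one _)]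

theorem substFrob_add (m : ℕ) (M M' : SeriesMat p n) :
    substFrob p m (M + M') = substFrob p m M + substFrob p m M' := by
  ext i j : 2; simp [substFrob]

theorem substFrob_const (m : ℕ) (N : ConstMat p n) :
    substFrob p m (N.map PowerSeries.C) = N.map PowerSeries.C := by
  ext i j : 2; simp [substFrob, PowerSeries.expand_C]

theorem substFrob_zero (M : SeriesMat p n) : substFrob p 0 M = M := by
  refine Matrix.ext fun i j => ?_
  simp only [substFrob, Matrix.map_apply, pow_zero]
  exact PowerSeries.expand_one_apply (R := ℚ_[p]) _

theorem substFrob_substFrob (m k : ℕ) (M : SeriesMat p n) :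
    substFrob p m (substFrob p k M) = substFrob p (m + k) M := by
  refine Matrix.ext fun i j => ?_
  simp only [substFrob, Matrix.map_apply, pow_add]
  exact (PowerSeries.expand_mul (R := ℚ_[p]) _ _ _ _ _).symm

theorem evalZero_substFrob (m : ℕ) (M : SeriesMat p n) :
    evalZero (substFrob p m M) = evalZero M := by
  ext i j; simp [substFrob, evalZero]

theorem map_delta_substFrob (m : ℕ) (M : SeriesMat p n) :
    (substFrob p m M).map (delta p) = (p : ℚ_[p]) ^ m • substFrob p m (M.map (delta p)) := by
  refine seriesMat_ext fun k => ?_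
  rw [coeffMat_delta, coeffMat_smul]
  by_cases h : p ^ m ∣ k
  · obtain ⟨k, rfl⟩ := h
    rw [coeffMat_substFrob_mul, coeffMat_substFrob_mul, coeffMat_delta, smul_smul]
    push_cast
    rfl
  · rw [coeffMat_substFrob_of_not_dvd _ _ _ h, coeffMat_substFrob_of_not_dvd _ _ _ h, smul_zero,
      smul_zero]

theorem substFrob_isUnit {m : ℕ} {M : SeriesMat p n} (h : IsUnit M) :
    IsUnit (substFrob p m M) := by
  rw [isUnit_iff_exists]
  refine ⟨substFrob p m M⁻¹, ?_, ?_⟩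
  · rw [← substFrob_mul, mul_inv_of_isUnit h, substFrob_one]
  · rw [← substFrob_mul, inv_mul_of_isUnit h, substFrob_one]

theorem coeffBound_substFrob_iff {m : ℕ} {c : ℝ} {M : SeriesMat p n} (hc : 0 ≤ c) :
    CoeffBound c (substFrob p m M) ↔ CoeffBound c M := by
  constructor
  · intro h i j k
    have := h i j (p ^ m * k)
    rwa [substFrob, Matrix.map_apply, PowerSeries.coeff_expand_mul] at this
  · intro h i j k
    rw [substFrob, Matrix.map_apply]
    by_cases hk : p ^ m ∣ k
    · obtain ⟨k, rfl⟩ := hk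
      rw [PowerSeries.coeff_expand_mul]
      exact h i j k
    · rw [PowerSeries.coeff_expand_of_not_dvd _ _ _ hk, norm_zero]
      exact hc

/-! ### The Frobenius antecedent -/

theorem natCast_p_ne_zero : (p : ℚ_[p]) ≠ 0 :=
  Nat.cast_ne_zero.2 (Fact.out : p.Prime).ne_zero

/-- The matrix `diag(1, p⁻¹, …) Λ_p(Y) diag(1, p, …)`. -/
noncomputable def antecedent (Y : SeriesMat p n) : SeriesMat p n :=
  powDiag n (p : ℚ_[p])⁻¹ * Y.map (cartier p) * powDiag n (p : ℚ_[p])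

theorem coeffMat_antecedent (k : ℕ) (Y : SeriesMat p n) :
    coeffMat k (antecedent Y) =
      constPowDiag n (p : ℚ_[p])⁻¹ * coeffMat (k * p) Y * constPowDiag n (p : ℚ_[p]) := by
  rw [antecedent, powDiag_eq_map, powDiag_eq_map, coeffMat_mul_const, coeffMat_const_mul,
    coeffMat_cartier]

theorem evalZero_antecedent {Y : SeriesMat p n} (h : evalZero Y = 1) :
    evalZero (antecedent Y) = 1 := by
  rw [evalZero_eq_coeffMat] at h ⊢
  rw [coeffMat_antecedent, zero_mul, h, mul_one, constPowDiag_inv_mul natCast_p_ne_zero]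

/-- The matrix of the system satisfied by `Z z^N`, where `Z` is the antecedent of `Y`. -/
noncomputable def antecedentMat (Y : SeriesMat p n) : SeriesMat p n :=
  ((antecedent Y).map (delta p) + antecedent Y * (shiftMat p n).map PowerSeries.C) *
    (antecedent Y)⁻¹

/-- The operator whose companion matrix is `antecedentMat Y`: its coefficients are read off from
the last row. -/
noncomputable def antecedentOp (Y : SeriesMat p n) : MonicDiffOp p n where
  coeff j := -antecedentMat Y ⟨n - 1, by have := j.2; omega⟩ j

theorem isLogFreeSolution_antecedent {Y : SeriesMat p n} (h0 : evalZero Y = 1) :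
    IsLogFreeSolution (antecedentMat Y) (shiftMat p n) (antecedent Y) := by
  have hu := isUnit_of_evalZero_eq_one (evalZero_antecedent h0)
  exact ⟨hu, by rw [antecedentMat, mul_assoc, inv_mul_of_isUnit hu, mul_one]⟩

/-- The rows of a solution of a companion system are `f, δ f, δ² f, …`, and
`Λ_p δ = p δ Λ_p`: this is why the antecedent again solves a companion system. -/
theorem companion_antecedentOp {L : MonicDiffOp p n} {Y : SeriesMat p n}
    (h : IsLogFreeSolution L.companion (shiftMat p n) Y) (h0 : evalZero Y = 1) :
    (antecedentOp Y).companion = antecedentMat Y := by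
  have hp := natCast_p_ne_zero (p := p)
  set Z := antecedent Y with hZ
  have hu : IsUnit Z := isUnit_of_evalZero_eq_one (evalZero_antecedent h0)
  have hcoef : ∀ k, coeffMat k (Z.map (delta p) + Z * (shiftMat p n).map PowerSeries.C) =
      (p : ℚ_[p])⁻¹ • (constPowDiag n (p : ℚ_[p])⁻¹ * coeffMat (k * p) (L.companion * Y) *
        constPowDiag n (p : ℚ_[p])) := by
    intro k
    rw [← h.delta_eq, coeffMat_add, coeffMat_add, coeffMat_mul_const, coeffMat_mul_const,
      coeffMat_delta, coeffMat_delta, hZ, coeffMat_antecedent, mul_add, add_mul, smul_add,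
      mul_smul_comm, smul_mul_assoc, smul_smul]
    congr 1
    · push_cast
      rw [mul_comm (k : ℚ_[p]), inv_mul_cancel_left₀ hp]
    · rw [mul_assoc _ (_ * shiftMat p n), mul_assoc _ (shiftMat p n), shiftMat_mul_constPowDiag,
        mul_smul_comm, mul_smul_comm, smul_smul, inv_mul_cancel₀ hp, one_smul]
      simp only [mul_assoc]
  have hrow : ∀ (i : Fin n) (hi : (i : ℕ) + 1 < n) (j : Fin n),
      (Z.map (delta p) + Z * (shiftMat p n).map PowerSeries.C) i j = Z ⟨i + 1, hi⟩ j := by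
    intro i hi j
    have hAY : ∀ x, (L.companion * Y) i x = Y ⟨i + 1, hi⟩ x := by
      intro x
      rw [Matrix.mul_apply, Finset.sum_eq_single ⟨i + 1, hi⟩]
      · simp [MonicDiffOp.companion, hi.ne]
      · intro b _ hb
        have : (b : ℕ) ≠ i + 1 := fun h' => hb (Fin.ext h')
        simp [MonicDiffOp.companion, hi.ne, this]
      · simp
    ext k
    have h1 := congrFun (congrFun (hcoef k) i) j
    have h2 := congrFun (congrFun (coeffMat_antecedent k Y) ⟨i + 1, hi⟩) j
    rw [← hZ] at h2
    refine h1.trans (Eq.trans ?_ h2.symm)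
    simp only [constPowDiag, Matrix.smul_apply, Matrix.mul_diagonal, Matrix.diagonal_mul, coeffMat,
      Matrix.map_apply, hAY, smul_eq_mul, pow_succ]
    ring
  apply Matrix.ext
  intro i j
  simp only [MonicDiffOp.companion, Matrix.of_apply]
  split_ifs with h1 h2
  · have : i = ⟨n - 1, by omega⟩ := Fin.ext (by simp; omega)
    simp [antecedentOp, this]
  all_goals
    have hi : (i : ℕ) + 1 < n := by omega
    have h3 : antecedentMat Y i j = (Z * Z⁻¹) ⟨i + 1, hi⟩ j := by
      rw [antecedentMat, ← hZ, Matrix.mul_apply, Matrix.mul_apply]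
      exact Finset.sum_congr rfl fun x _ => by rw [hrow i hi x]
    rw [h3, mul_inv_of_isUnit hu, Matrix.one_apply]
  · rw [if_pos (Fin.ext h2.symm)]
  · rw [if_neg fun h' => h2 (by rw [← h'])]

theorem evalZero_antecedentMat {Y : SeriesMat p n} (h0 : evalZero Y = 1) :
    evalZero (antecedentMat Y) = shiftMat p n := by
  have hs := isLogFreeSolution_antecedent h0
  have h1 := congrArg (coeffMat 0) hs.delta_eq
  have hz := evalZero_antecedent h0
  rw [coeffMat_add, coeffMat_delta, coeffMat_mul_const, Nat.cast_zero, zero_smul, zero_add,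
    ← evalZero_eq_coeffMat, ← evalZero_eq_coeffMat, evalZero_mul, hz, mul_one, one_mul] at h1
  exact h1.symm

theorem isMUM_antecedentOp {Y : SeriesMat p n} (h0 : evalZero Y = 1) :
    (antecedentOp Y).IsMUM := by
  intro j
  have h1 := congrFun (congrFun (evalZero_antecedentMat h0) ⟨n - 1, by have := j.2; omega⟩) j
  have h2 : PowerSeries.constantCoeff (antecedentMat Y ⟨n - 1, by have := j.2; omega⟩ j) = 0 := by
    refine h1.trans ?_
    have := j.2
    simp only [shiftMat, Matrix.of_apply]
    rw [if_neg (by omega)]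
  simp only [antecedentOp, map_neg, h2, neg_zero]

/-! ### Integrality of the Frobenius matrix -/

/-- The matrix `Λ_p(Y)(z^p) Y⁻¹`. -/
noncomputable def frobMat (Y : SeriesMat p n) : SeriesMat p n :=
  substFrob p 1 (Y.map (cartier p)) * Y⁻¹

theorem substFrob_cartier (Y : SeriesMat p n) :
    substFrob p 1 (Y.map (cartier p)) = coeffTwist Y fun k => if p ∣ k then 1 else 0 := by
  refine seriesMat_ext fun k => ?_
  rw [coeffMat_coeffTwist]
  split_ifs with h
  · obtain ⟨k, rfl⟩ := h
    have := coeffMat_substFrob_mul 1 k (Y.map (cartier p))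
    rw [pow_one] at this
    rw [this, coeffMat_cartier, mul_one, mul_comm]
  · rw [coeffMat_substFrob_of_not_dvd _ _ _ (by rwa [pow_one]), mul_zero]

theorem coeffBound_frobMat {A Y : SeriesMat p n} (hA : CoeffBound 1 A)
    (h : IsLogFreeSolution A (shiftMat p n) Y) : CoeffBound 1 (frobMat Y) := by
  rw [frobMat, substFrob_cartier]
  refine coeffBound_of_tendsto (tendsto_shiftEval shiftMat_pow_self)
    (Filter.Eventually.of_forall fun s => ?_)
  have := coeffBound_opMat h hA (1 - Polynomial.X ^ ((p - 1) * p ^ s))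
  simpa using this

theorem evalZero_frobMat {Y : SeriesMat p n} (h0 : evalZero Y = 1) :
    evalZero (frobMat Y) = 1 := by
  have hu := isUnit_of_evalZero_eq_one h0
  have h1 : frobMat Y * Y = substFrob p 1 (Y.map (cartier p)) := by
    rw [frobMat, mul_assoc, inv_mul_of_isUnit hu, mul_one]
  have h2 := congrArg evalZero h1
  rw [evalZero_mul, h0, mul_one, evalZero_substFrob, evalZero_eq_coeffMat (Y.map _),
    coeffMat_cartier, zero_mul, ← evalZero_eq_coeffMat, h0] at h2
  exact h2

/-! ### Binomial polynomials on `pℤ_p` -/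

/-- The polynomial `x (x - p) ⋯ (x - p (j-1))`, which is `p^j j!` times the binomial coefficient
of `x / p` and `j`. -/
noncomputable def scaledPoch (p : ℕ) (j : ℕ) : Polynomial ℤ :=
  ∏ i ∈ Finset.range j, (Polynomial.X - Polynomial.C ((p : ℤ) * i))

/-- A polynomial approximation of the function on `ℤ_p` that is the binomial coefficient of
`x / p` and `j` on `pℤ_p` and `0` elsewhere. -/
noncomputable def approxBinom (p : ℕ) [Fact p.Prime] (j s : ℕ) : Polynomial ℚ_[p] :=
  ((p : ℚ_[p]) ^ j * (j.factorial : ℚ_[p]))⁻¹ •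
    ((1 - Polynomial.X ^ ((p - 1) * p ^ s)) * scaledPoch p j).map (Int.castRingHom ℚ_[p])

/-- The value at `k + N` of the function approximated by `approxBinom p j`. -/
noncomputable def binomLimit (p n : ℕ) [Fact p.Prime] (j k : ℕ) : ConstMat p n :=
  if p ∣ k then ((p : ℚ_[p]) ^ j * (j.factorial : ℚ_[p]))⁻¹ •
    shiftEval (shiftMat p n) ((scaledPoch p j).map (Int.castRingHom ℚ_[p])) k else 0

theorem tendsto_approxBinom (j k : ℕ) :
    Filter.Tendsto (fun s => shiftEval (shiftMat p n) (approxBinom p j s) k) Filter.atTop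
      (nhds (binomLimit p n j k)) := by
  have h := ((tendsto_shiftEval (shiftMat_pow_self (p := p) (n := n)) k).mul_const
    (shiftEval (shiftMat p n) ((scaledPoch p j).map (Int.castRingHom ℚ_[p])) k)).const_smul
    ((p : ℚ_[p]) ^ j * (j.factorial : ℚ_[p]))⁻¹
  convert h using 2
  · simp only [approxBinom, shiftEval, map_smul, Polynomial.map_mul, map_mul, Polynomial.map_sub,
      Polynomial.map_one, Polynomial.map_pow, Polynomial.map_X]
  · rw [binomLimit]
    split_ifs <;> simp

/-- Conjugation by `diag(1, p, …)` multiplies `N` by `p`, so that it turns binomial coefficients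
of `k + N` into binomial coefficients of `(pk + N) / p`. -/
theorem constPowDiag_mul_shiftEval (j k : ℕ) :
    constPowDiag n (p : ℚ_[p]) * shiftEval (shiftMat p n) (descPochhammer ℚ_[p] j) k =
      ((p : ℚ_[p]) ^ j)⁻¹ • (shiftEval (shiftMat p n)
        ((scaledPoch p j).map (Int.castRingHom ℚ_[p])) (k * p) * constPowDiag n (p : ℚ_[p])) := by
  have hp := natCast_p_ne_zero (p := p)
  induction j with
  | zero => simp [shiftEval, scaledPoch]
  | succ j ih =>
    have hstep : constPowDiag n (p : ℚ_[p]) *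
        ((k : ℚ_[p]) • (1 : ConstMat p n) + shiftMat p n - (j : ℚ_[p]) • 1) =
        (p : ℚ_[p])⁻¹ • ((((k * p : ℕ) : ℚ_[p]) • (1 : ConstMat p n) + shiftMat p n -
          ((p : ℚ_[p]) * j) • 1) * constPowDiag n (p : ℚ_[p])) := by
      rw [sub_mul, add_mul, shiftMat_mul_constPowDiag, mul_sub, mul_add, smul_mul_assoc,
        smul_mul_assoc, mul_smul_comm, mul_smul_comm, mul_one, one_mul, smul_sub, smul_add,
        smul_smul, smul_smul, smul_smul, inv_mul_cancel₀ hp, one_smul, inv_mul_cancel_left₀ hp]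
      push_cast
      rw [mul_comm (k : ℚ_[p]), inv_mul_cancel_left₀ hp]
    have h1 : shiftEval (shiftMat p n) (descPochhammer ℚ_[p] (j + 1)) k =
        shiftEval (shiftMat p n) (descPochhammer ℚ_[p] j) k *
          ((k : ℚ_[p]) • (1 : ConstMat p n) + shiftMat p n - (j : ℚ_[p]) • 1) := by
      rw [descPochhammer_succ_right, ← Polynomial.C_eq_natCast]
      simp only [shiftEval, map_mul, map_sub, Polynomial.aeval_X, Polynomial.aeval_C,
        Algebra.algebraMap_eq_smul_one]
    have h2 : shiftEval (shiftMat p n)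
        ((scaledPoch p (j + 1)).map (Int.castRingHom ℚ_[p])) (k * p) =
        shiftEval (shiftMat p n) ((scaledPoch p j).map (Int.castRingHom ℚ_[p])) (k * p) *
          (((k * p : ℕ) : ℚ_[p]) • (1 : ConstMat p n) + shiftMat p n -
            ((p : ℚ_[p]) * j) • 1) := by
      rw [scaledPoch, Finset.prod_range_succ, ← scaledPoch]
      have hc : (Polynomial.X - Polynomial.C ((p : ℤ) * j)).map (Int.castRingHom ℚ_[p]) =
          Polynomial.X - Polynomial.C ((p : ℚ_[p]) * j) := by
        rw [Polynomial.map_sub, Polynomial.map_X, Polynomial.map_C]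
        simp
      rw [Polynomial.map_mul, hc, shiftEval, shiftEval, map_mul, map_sub, Polynomial.aeval_X,
        Polynomial.aeval_C, Algebra.algebraMap_eq_smul_one]
    rw [h1, h2, ← mul_assoc, ih, smul_mul_assoc, mul_assoc, hstep, mul_smul_comm, smul_smul,
      ← mul_assoc, pow_succ, mul_inv]

/-- The matrices of the generic solution of the antecedent, after the substitution `z ↦ z^p`, are
obtained from those of the original system. -/
theorem substFrob_genericMatrix {Y : SeriesMat p n} (h0 : evalZero Y = 1) (j : ℕ) :
    substFrob p 1 ((j.factorial : ℚ_[p])⁻¹ • genericMatrix (antecedentMat Y) j) =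
      powDiag n (p : ℚ_[p])⁻¹ * (coeffTwist Y (binomLimit p n j) * Y⁻¹) * (frobMat Y)⁻¹ *
        powDiag n (p : ℚ_[p]) := by
  have hp := natCast_p_ne_zero (p := p)
  have hY := isUnit_of_evalZero_eq_one h0
  have hs := isLogFreeSolution_antecedent h0
  set Z := antecedent Y with hZ
  set G := (j.factorial : ℚ_[p])⁻¹ • genericMatrix (antecedentMat Y) j with hG
  have hF := isUnit_of_evalZero_eq_one (evalZero_frobMat h0)
  -- both sides agree after multiplication by `Z(z^p)`
  have h1 : substFrob p 1 G * substFrob p 1 Z =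
      powDiag n (p : ℚ_[p])⁻¹ * coeffTwist Y (binomLimit p n j) * powDiag n (p : ℚ_[p]) := by
    rw [hG, ← opMat_descPochhammer hs, ← substFrob_mul, smul_mul_assoc, opMat_mul_self hs.isUnit]
    refine seriesMat_ext fun k => ?_
    rw [powDiag_eq_map, powDiag_eq_map, coeffMat_mul_const, coeffMat_const_mul,
      coeffMat_coeffTwist]
    by_cases hk : p ∣ k
    · obtain ⟨k, rfl⟩ := hk
      have h2 := coeffMat_substFrob_mul (n := n) 1 k
        ((j.factorial : ℚ_[p])⁻¹ • coeffTwist Z (shiftEval (shiftMat p n) (descPochhammer ℚ_[p] j)))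
      rw [pow_one] at h2
      rw [h2, coeffMat_smul, coeffMat_coeffTwist, hZ, coeffMat_antecedent, binomLimit,
        if_pos (Dvd.intro k rfl), mul_assoc _ (constPowDiag n _) (shiftEval _ _ _),
        constPowDiag_mul_shiftEval, mul_comm p k]
      simp only [mul_smul_comm, smul_mul_assoc, smul_smul, mul_assoc, mul_inv]
      rw [mul_comm]
    · rw [coeffMat_substFrob_of_not_dvd _ _ _ (by rwa [pow_one]), binomLimit, if_neg hk]
      simp
  have h2 : substFrob p 1 Z = powDiag n (p : ℚ_[p])⁻¹ * (frobMat Y * Y) *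
      powDiag n (p : ℚ_[p]) := by
    rw [frobMat, mul_assoc (substFrob p 1 _), inv_mul_of_isUnit hY, mul_one, hZ, antecedent,
      substFrob_mul, substFrob_mul, powDiag_eq_map, powDiag_eq_map, substFrob_const,
      substFrob_const]
  have h3 : substFrob p 1 Z *
      (powDiag n (p : ℚ_[p])⁻¹ * Y⁻¹ * (frobMat Y)⁻¹ * powDiag n (p : ℚ_[p])) = 1 := by
    rw [h2]
    calc _ = powDiag n (p : ℚ_[p])⁻¹ * (frobMat Y * (Y * ((powDiag n (p : ℚ_[p]) *
          powDiag n (p : ℚ_[p])⁻¹) * Y⁻¹) * (frobMat Y)⁻¹)) * powDiag n (p : ℚ_[p]) := by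
          simp only [mul_assoc]
      _ = 1 := by
        rw [powDiag_mul_inv hp, one_mul, mul_inv_of_isUnit hY, one_mul, mul_inv_of_isUnit hF,
          mul_one, powDiag_inv_mul hp]
  calc substFrob p 1 G = (substFrob p 1 G * substFrob p 1 Z) *
        (powDiag n (p : ℚ_[p])⁻¹ * Y⁻¹ * (frobMat Y)⁻¹ * powDiag n (p : ℚ_[p])) := by
        rw [mul_assoc, h3, mul_one]
    _ = powDiag n (p : ℚ_[p])⁻¹ * coeffTwist Y (binomLimit p n j) * ((powDiag n (p : ℚ_[p]) *
        powDiag n (p : ℚ_[p])⁻¹) * Y⁻¹) * (frobMat Y)⁻¹ * powDiag n (p : ℚ_[p]) := by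
        rw [h1]; simp only [mul_assoc]
    _ = _ := by rw [powDiag_mul_inv hp, one_mul]; simp only [mul_assoc]

/-! ### Newton expansions -/

theorem exists_newton_expansion (P : Polynomial ℤ) :
    ∃ c : ℕ →₀ ℤ, P = ∑ i ∈ c.support, c i • descPochhammer ℤ i := by
  have hX : ∀ Q ∈ Submodule.span ℤ (Set.range (descPochhammer ℤ)),
      Q * Polynomial.X ∈ Submodule.span ℤ (Set.range (descPochhammer ℤ)) := by
    intro Q hQ
    induction hQ using Submodule.span_induction with
    | mem Q hQ =>
      obtain ⟨i, rfl⟩ := hQ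
      have : descPochhammer ℤ i * Polynomial.X =
          descPochhammer ℤ (i + 1) + (i : ℤ) • descPochhammer ℤ i := by
        rw [descPochhammer_succ_right, zsmul_eq_mul]; push_cast; ring
      rw [this]
      exact add_mem (Submodule.subset_span ⟨_, rfl⟩)
        (Submodule.smul_mem _ _ (Submodule.subset_span ⟨_, rfl⟩))
    | zero => rw [zero_mul]; exact zero_mem _
    | add Q R _ _ hQ hR => rw [add_mul]; exact add_mem hQ hR
    | smul a Q _ hQ => rw [smul_mul_assoc]; exact Submodule.smul_mem _ _ hQ
  have hP : P ∈ Submodule.span ℤ (Set.range (descPochhammer ℤ)) := by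
    induction P using Polynomial.induction_on' with
    | add P Q hP hQ => exact add_mem hP hQ
    | monomial k a =>
      rw [← Polynomial.smul_X_eq_monomial]
      refine Submodule.smul_mem _ _ ?_
      induction k with
      | zero =>
        exact Submodule.subset_span ⟨0, by rw [descPochhammer_zero, pow_zero]⟩
      | succ k ih => rw [pow_succ]; exact hX _ ih
  obtain ⟨c, hc⟩ := (Finsupp.mem_span_range_iff_exists_finsupp).1 hP
  exact ⟨c, hc.symm⟩

/-- Newton coefficients are integral up to the index up to which the values are integral. -/
theorem norm_newton_le_one {a : ℕ → ℚ_[p]} {s : Finset ℕ} (hs : ∀ i ∉ s, a i = 0) {I : ℕ}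
    (h : ∀ k < I, ‖∑ i ∈ s, a i * (k.choose i : ℚ_[p])‖ ≤ 1) : ∀ i < I, ‖a i‖ ≤ 1 := by
  intro i
  induction i using Nat.strong_induction_on with
  | _ i ih =>
    intro hi
    by_cases his : i ∈ s
    · have h1 := h i hi
      rw [← Finset.add_sum_erase s _ his, Nat.choose_self, Nat.cast_one, mul_one] at h1
      have h2 : ‖∑ x ∈ s.erase i, a x * (i.choose x : ℚ_[p])‖ ≤ 1 := by
        refine IsUltrametricDist.norm_sum_le_of_forall_le_of_nonneg zero_le_one fun x hx => ?_
        rcases lt_trichotomy x i with hlt | heq | hgt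
        · rw [norm_mul]
          refine mul_le_one₀ (ih x hlt (hlt.trans hi)) (norm_nonneg _) ?_
          simpa using Padic.norm_int_le_one (p := p) (i.choose x : ℤ)
        · exact absurd heq (Finset.ne_of_mem_erase hx)
        · rw [Nat.choose_eq_zero_of_lt hgt]; simp
      have h3 : a i = (a i + ∑ x ∈ s.erase i, a x * (i.choose x : ℚ_[p])) -
          ∑ x ∈ s.erase i, a x * (i.choose x : ℚ_[p]) := by ring
      rw [h3, sub_eq_add_neg]
      exact (IsUltrametricDist.norm_add_le_max _ _).trans (max_le h1 (by rwa [norm_neg]))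
    · rw [hs i his]; simp

theorem norm_factorial_le (i : ℕ) :
    ‖(i.factorial : ℚ_[p])‖ ≤ ((p : ℝ)⁻¹) ^ (i / p) := by
  have hp : p.Prime := Fact.out
  have h1 : p ^ (i / p) ∣ i.factorial := by
    have h2 : p.factorial ^ (i / p) ∣ (p * (i / p)).factorial := by
      have := Nat.prod_factorial_dvd_factorial_sum (Finset.range (i / p)) fun _ => p
      simpa [mul_comm p] using this
    exact (pow_dvd_pow_of_dvd (Nat.dvd_factorial hp.pos le_rfl) _).trans
      (h2.trans (Nat.factorial_dvd_factorial (Nat.mul_div_le i p)))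
  have h3 := (Padic.norm_int_le_pow_iff_dvd (p := p) (i.factorial : ℤ) (i / p)).2
    (by exact_mod_cast h1)
  rw [zpow_neg, ← inv_zpow, zpow_natCast] at h3
  exact_mod_cast h3

theorem norm_inv_factorial_le (j : ℕ) : ‖(j.factorial : ℚ_[p])⁻¹‖ ≤ (p : ℝ) ^ j := by
  have hp : p.Prime := Fact.out
  have h0 : (j.factorial : ℚ_[p]) ≠ 0 := by exact_mod_cast j.factorial_ne_zero
  have h1 : padicValNat p j.factorial ≤ j := by
    have h2 := sub_one_mul_padicValNat_factorial (p := p) j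
    have h3 : 1 ≤ p - 1 := Nat.sub_pos_of_lt hp.one_lt
    nlinarith [Nat.sub_le j (p.digits j).sum]
  rw [norm_inv, Padic.norm_eq_zpow_neg_valuation h0, Padic.valuation_natCast, ← zpow_neg, neg_neg,
    zpow_natCast]
  exact pow_le_pow_right₀ (by exact_mod_cast hp.one_le) h1

theorem tail_bound {q : ℝ} (hq : 1 ≤ q) (hqp : q ^ (2 * p) ≤ p) {i j : ℕ} (h : 4 * p * j ≤ i) :
    (p : ℝ) ^ (2 * j) * ((p : ℝ)⁻¹) ^ (i / p) * q ^ i ≤ p := by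
  have hp : p.Prime := Fact.out
  have hp1 : (1 : ℝ) ≤ p := by exact_mod_cast hp.one_le
  set t := i / p with ht
  have ht4 : 4 * j ≤ t := by
    rw [ht, Nat.le_div_iff_mul_le hp.pos]; linarith
  have hit : i ≤ p * (t + 1) := (Nat.lt_mul_div_succ i hp.pos).le
  have hq0 : (0 : ℝ) ≤ q := zero_le_one.trans hq
  have h1 : (q ^ i) ^ 2 ≤ (p : ℝ) ^ (t + 1) := by
    calc (q ^ i) ^ 2 = q ^ (2 * i) := by rw [← pow_mul, mul_comm]
      _ ≤ q ^ (2 * p * (t + 1)) := pow_le_pow_right₀ hq (by nlinarith)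
      _ = (q ^ (2 * p)) ^ (t + 1) := pow_mul _ _ _
      _ ≤ (p : ℝ) ^ (t + 1) := pow_le_pow_left₀ (by positivity) hqp _
  refine le_of_sq_le_sq ?_ (by positivity)
  calc ((p : ℝ) ^ (2 * j) * ((p : ℝ)⁻¹) ^ t * q ^ i) ^ 2
      = (p : ℝ) ^ (4 * j) * (((p : ℝ)⁻¹) ^ t) ^ 2 * (q ^ i) ^ 2 := by ring
    _ ≤ (p : ℝ) ^ t * (((p : ℝ)⁻¹) ^ t) ^ 2 * (p : ℝ) ^ (t + 1) := by
        gcongr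
    _ = p := by
        have : ((p : ℝ)⁻¹) ^ t * (p : ℝ) ^ t = 1 := by
          rw [← mul_pow, inv_mul_cancel₀ (by positivity), one_pow]
        calc _ = (((p : ℝ)⁻¹) ^ t * (p : ℝ) ^ t) ^ 2 * p := by ring
          _ = p := by rw [this]; ring
    _ ≤ (p : ℝ) ^ 2 := by nlinarith

/-! ### Growth of the generic solution of the antecedent -/

theorem eval_scaledPoch (j k : ℕ) :
    ((scaledPoch p j).map (Int.castRingHom ℚ_[p])).eval ((p * k : ℕ) : ℚ_[p]) =
      (p : ℚ_[p]) ^ j * (k.descFactorial j : ℚ_[p]) := by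
  induction j with
  | zero => simp [scaledPoch]
  | succ j ih =>
    rw [scaledPoch, Finset.prod_range_succ, ← scaledPoch, Polynomial.map_mul, Polynomial.eval_mul,
      ih, ← descPochhammer_eval_eq_descFactorial, ← descPochhammer_eval_eq_descFactorial,
      descPochhammer_succ_eval]
    simp
    ring

/-- The approximations take integral values at each given natural number, from some point on. -/
theorem eventually_norm_eval_approxBinom (j k : ℕ) :
    ∀ᶠ s in Filter.atTop, ‖(approxBinom p j s).eval (k : ℚ_[p])‖ ≤ 1 := by
  have hp := natCast_p_ne_zero (p := p)
  have hval : ∀ s, (approxBinom p j s).eval (k : ℚ_[p]) =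
      ((p : ℚ_[p]) ^ j * (j.factorial : ℚ_[p]))⁻¹ * ((1 - (k : ℚ_[p]) ^ ((p - 1) * p ^ s)) *
        ((scaledPoch p j).map (Int.castRingHom ℚ_[p])).eval (k : ℚ_[p])) := by
    intro s
    simp [approxBinom, Polynomial.map_mul]
  by_cases hk : p ∣ k
  · refine Filter.Eventually.of_forall fun s => ?_
    obtain ⟨k, rfl⟩ := hk
    have h0 : (j.factorial : ℚ_[p]) ≠ 0 := by exact_mod_cast j.factorial_ne_zero
    rw [hval, eval_scaledPoch, Nat.descFactorial_eq_factorial_mul_choose]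
    have : ((p : ℚ_[p]) ^ j * (j.factorial : ℚ_[p]))⁻¹ *
        ((1 - ((p * k : ℕ) : ℚ_[p]) ^ ((p - 1) * p ^ s)) *
          ((p : ℚ_[p]) ^ j * ((j.factorial * k.choose j : ℕ) : ℚ_[p]))) =
        (((1 - ((p * k : ℕ) : ℤ) ^ ((p - 1) * p ^ s)) * (k.choose j : ℤ) : ℤ) : ℚ_[p]) := by
      push_cast
      field_simp
    rw [this]
    exact Padic.norm_int_le_one _
  · have h1 : Filter.Tendsto (fun s => (approxBinom p j s).eval (k : ℚ_[p])) Filter.atTop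
        (nhds 0) := by
      simp only [hval]
      have h2 := tendsto_natCast_pow (p := p) k
      rw [if_neg hk] at h2
      have h3 := ((h2.const_sub 1).mul_const (((scaledPoch p j).map
        (Int.castRingHom ℚ_[p])).eval (k : ℚ_[p]))).const_mul
          ((p : ℚ_[p]) ^ j * (j.factorial : ℚ_[p]))⁻¹
      simpa using h3
    rw [tendsto_zero_iff_norm_tendsto_zero] at h1
    exact (h1.eventually (gt_mem_nhds zero_lt_one)).mono fun s hs => hs.le

/-- The Newton coefficients of the approximations are integral, and the ones of large index are
small because all Newton coefficients of an integral polynomial are divisible by factorials. -/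
theorem eventually_coeffBound_approxBinom {A Y : SeriesMat p n}
    (h : IsLogFreeSolution A (shiftMat p n) Y) {C q : ℝ} (hC : 0 ≤ C) (hq : 1 ≤ q)
    (hqp : q ^ (2 * p) ≤ p)
    (hb : ∀ i, CoeffBound (C * q ^ i) ((i.factorial : ℚ_[p])⁻¹ • genericMatrix A i)) (j : ℕ) :
    ∀ᶠ s in Filter.atTop, CoeffBound (C * p * q ^ (4 * p * j))
      (opMat (shiftMat p n) Y (approxBinom p j s)) := by
  have hp1 : (1 : ℝ) ≤ p := by exact_mod_cast (Fact.out : p.Prime).one_le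
  have hq0 : (0 : ℝ) ≤ q := zero_le_one.trans hq
  have hev : ∀ᶠ s in Filter.atTop, ∀ k ∈ Finset.range (4 * p * j),
      ‖(approxBinom p j s).eval (k : ℚ_[p])‖ ≤ 1 :=
    (Filter.eventually_all_finset _).2 fun k _ => eventually_norm_eval_approxBinom j k
  filter_upwards [hev] with s hs
  obtain ⟨c, hc⟩ := exists_newton_expansion
    ((1 - Polynomial.X ^ ((p - 1) * p ^ s)) * scaledPoch p j)
  set b : ℚ_[p] := ((p : ℚ_[p]) ^ j * (j.factorial : ℚ_[p]))⁻¹ with hbdef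
  have hexp : approxBinom p j s =
      ∑ i ∈ c.support, (b * (c i : ℚ_[p])) • descPochhammer ℚ_[p] i := by
    rw [approxBinom, hc, Polynomial.map_sum, Finset.smul_sum]
    refine Finset.sum_congr rfl fun i _ => ?_
    rw [zsmul_eq_mul, Polynomial.map_mul, descPochhammer_map, Polynomial.map_intCast, mul_smul,
      Int.cast_smul_eq_zsmul, zsmul_eq_mul]
  let a : ℕ → ℚ_[p] := fun i => b * (c i : ℚ_[p]) * (i.factorial : ℚ_[p])
  have ha : ∀ i < 4 * p * j, ‖a i‖ ≤ 1 := by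
    refine norm_newton_le_one (s := c.support) (fun i hi => ?_) fun k hk => ?_
    · simp [a, Finsupp.notMem_support_iff.1 hi]
    · have h1 := hs k (Finset.mem_range.2 hk)
      rw [hexp, Polynomial.eval_finsetSum] at h1
      convert h1 using 3 with i
      rw [Polynomial.eval_smul, descPochhammer_eval_eq_descFactorial,
        Nat.descFactorial_eq_factorial_mul_choose, smul_eq_mul]
      push_cast
      ring
  have hop : opMat (shiftMat p n) Y (approxBinom p j s) =
      ∑ i ∈ c.support, a i • ((i.factorial : ℚ_[p])⁻¹ • genericMatrix A i) := by
    rw [hexp, opMat_sum]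
    refine Finset.sum_congr rfl fun i _ => ?_
    have h0 : (i.factorial : ℚ_[p]) ≠ 0 := by exact_mod_cast i.factorial_ne_zero
    rw [opMat_smul, opMat_descPochhammer h, smul_smul, mul_inv_cancel_right₀ h0]
  have hqj : 1 ≤ q ^ (4 * p * j) := one_le_pow₀ hq
  rw [hop]
  refine CoeffBound.sum (by positivity) _ fun i _ => ((hb i).smul (a i)).mono ?_
  rcases lt_or_ge i (4 * p * j) with hi | hi
  · calc ‖a i‖ * (C * q ^ i) ≤ 1 * (C * q ^ (4 * p * j)) := by
          gcongr
          exact ha i hi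
      _ = C * 1 * q ^ (4 * p * j) := by ring
      _ ≤ C * p * q ^ (4 * p * j) := by gcongr
  · have hbn : ‖b‖ ≤ (p : ℝ) ^ (2 * j) := by
      rw [hbdef, mul_inv, norm_mul, two_mul, pow_add, norm_inv, norm_pow, Padic.norm_p, inv_pow,
        inv_inv]
      gcongr
      exact norm_inv_factorial_le j
    calc ‖a i‖ * (C * q ^ i)
        = ‖b‖ * ‖(c i : ℚ_[p])‖ * ‖(i.factorial : ℚ_[p])‖ * (C * q ^ i) := by
          simp only [a, norm_mul]
      _ ≤ (p : ℝ) ^ (2 * j) * 1 * ((p : ℝ)⁻¹) ^ (i / p) * (C * q ^ i) := by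
          gcongr
          · exact Padic.norm_int_le_one _
          · exact norm_factorial_le i
      _ = C * ((p : ℝ) ^ (2 * j) * ((p : ℝ)⁻¹) ^ (i / p) * q ^ i) := by ring
      _ ≤ C * p := by
          gcongr
          exact tail_bound hq hqp hi
      _ ≤ C * p * q ^ (4 * p * j) := le_mul_of_one_le_right (by positivity) hqj

theorem coeffBound_powDiag_p : CoeffBound 1 (powDiag n (p : ℚ_[p])) := by
  rw [coeffBound_one_iff]
  intro i j
  rw [powDiag, Matrix.diagonal_apply]
  split_ifs
  · refine (mem_integralSeries_iff _).2 fun k => ?_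
    rw [PowerSeries.coeff_C]
    split_ifs
    · rw [norm_pow]
      exact pow_le_one₀ (norm_nonneg _) Padic.norm_p_lt_one.le
    · simp
  · exact zero_mem _

theorem exists_coeffBound_const (N : ConstMat p n) :
    ∃ c : ℝ, 0 ≤ c ∧ CoeffBound c (N.map PowerSeries.C) := by
  refine ⟨∑ i, ∑ j, ‖N i j‖, by positivity, fun i j k => ?_⟩
  rw [Matrix.map_apply, PowerSeries.coeff_C]
  split_ifs
  · exact (Finset.single_le_sum (f := fun j => ‖N i j‖) (fun _ _ => norm_nonneg _)
      (Finset.mem_univ j)).trans (Finset.single_le_sum (f := fun i => ∑ j, ‖N i j‖)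
        (fun _ _ => Finset.sum_nonneg fun _ _ => norm_nonneg _) (Finset.mem_univ i))
  · rw [norm_zero]; positivity

/-- The generic solution of the system `δ X = A X` has radius of convergence at least `1`: the
norms of its coefficients `A_j / j!` grow slower than every geometric progression of ratio
`q > 1`. -/
def HasUnitRadius (A : SeriesMat p n) : Prop :=
  ∀ q : ℝ, 1 < q → ∃ C : ℝ, 0 ≤ C ∧
    ∀ j, CoeffBound (C * q ^ j) ((j.factorial : ℚ_[p])⁻¹ • genericMatrix A j)

theorem HasUnitRadius.antecedentMat {A Y : SeriesMat p n} (hr : HasUnitRadius A)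
    (hA : CoeffBound 1 A) (h : IsLogFreeSolution A (shiftMat p n) Y) (h0 : evalZero Y = 1) :
    HasUnitRadius (antecedentMat Y) := by
  intro q' hq'
  have hp : p.Prime := Fact.out
  have hp1 : (1 : ℝ) < p := by exact_mod_cast hp.one_lt
  -- a ratio `q` such that both `q ^ (2p) ≤ p` and `q ^ (4p) ≤ q'`
  obtain ⟨q, hq, hqp, hqq⟩ : ∃ q : ℝ, 1 < q ∧ q ^ (2 * p) ≤ p ∧ q ^ (4 * p) ≤ q' := by
    have h4 : (4 * p : ℕ) ≠ 0 := by have := hp.pos; omega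
    have hm : 1 < min q' (p : ℝ) := lt_min hq' hp1
    have hpos : 0 < ((4 * p : ℕ) : ℝ)⁻¹ := by
      have := hp.pos
      positivity
    have hq1 := Real.one_lt_rpow hm hpos
    have hpow : (min q' (p : ℝ) ^ (((4 * p : ℕ) : ℝ)⁻¹)) ^ (4 * p) = min q' p :=
      Real.rpow_inv_natCast_pow (zero_lt_one.trans hm).le h4
    refine ⟨_, hq1, ?_, hpow.trans_le (min_le_left _ _)⟩
    exact (pow_le_pow_right₀ hq1.le (by omega)).trans (hpow.trans_le (min_le_right _ _))
  obtain ⟨C, hC, hb⟩ := hr q hq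
  obtain ⟨c, hc, hcb⟩ := exists_coeffBound_const (constPowDiag n (p : ℚ_[p])⁻¹)
  rw [← powDiag_eq_map] at hcb
  have hq0 : (0 : ℝ) ≤ q := (zero_lt_one.trans hq).le
  refine ⟨c * (C * p), by positivity, fun j => ?_⟩
  have hFj : CoeffBound (C * p * q ^ (4 * p * j))
      (coeffTwist Y (binomLimit p n j) * Y⁻¹) :=
    coeffBound_of_tendsto (tendsto_approxBinom j)
      (eventually_coeffBound_approxBinom h hC hq.le hqp hb j)
  have hFinv : CoeffBound 1 (frobMat Y)⁻¹ :=
    (coeffBound_frobMat hA h).inv (evalZero_frobMat h0)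
  have hq'0 : (0 : ℝ) ≤ q' := (zero_lt_one.trans hq').le
  rw [← coeffBound_substFrob_iff (m := 1) (by positivity), substFrob_genericMatrix h0]
  have hd : (0 : ℝ) ≤ C * p * q ^ (4 * p * j) := by positivity
  refine (((hcb.mul hc hd hFj).mul (mul_nonneg hc hd) zero_le_one hFinv).mul
    (mul_nonneg (mul_nonneg hc hd) zero_le_one) zero_le_one coeffBound_powDiag_p).mono ?_
  rw [mul_one, mul_one, ← mul_assoc c, pow_mul]
  gcongr

/-! ### The radius of convergence -/

theorem hasUnitRadius_of_one_le_radius {L : MonicDiffOp p n} (hA : CoeffBound 1 L.companion)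
    (hr : 1 ≤ L.radius) : HasUnitRadius L.companion := by
  intro q hq
  have hq0 : (0 : ℝ) ≤ q := (zero_lt_one.trans hq).le
  rw [MonicDiffOp.radius, ENNReal.one_le_inv] at hr
  have hlt := hr.trans_lt (show (1 : ℝ≥0∞) < ENNReal.ofReal q by
    rwa [← ENNReal.ofReal_one, ENNReal.ofReal_lt_ofReal_iff (zero_lt_one.trans hq)])
  obtain ⟨J, hJ⟩ := Filter.eventually_atTop.1 (Filter.eventually_lt_of_limsup_lt hlt)
  refine ⟨1 + ∑ j ∈ Finset.range (J + 1), ‖(j.factorial : ℚ_[p])⁻¹‖, by positivity, fun j => ?_⟩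
  have hqj : 1 ≤ q ^ j := one_le_pow₀ hq.le
  rcases lt_or_ge j (J + 1) with hj | hj
  · refine ((coeffBound_genericMatrix hA j).smul _).mono ?_
    rw [mul_one]
    have h1 := Finset.single_le_sum (f := fun j => ‖((Nat.factorial j : ℕ) : ℚ_[p])⁻¹‖)
      (fun _ _ => norm_nonneg _) (Finset.mem_range.2 hj)
    refine (h1.trans (le_add_of_nonneg_left zero_le_one)).trans
      (le_mul_of_one_le_right (by positivity) hqj)
  · have h1 := (hJ j (by omega)).le
    have hj0 : (0 : ℝ) < j := by exact_mod_cast (by omega : 0 < j)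
    rw [one_div, ENNReal.rpow_inv_le_iff hj0, ENNReal.rpow_natCast,
      ← ENNReal.ofReal_pow hq0, matNorm_le_ofReal_iff (by positivity)] at h1
    refine h1.mono (le_mul_of_one_le_left (by positivity) ?_)
    exact le_add_of_nonneg_right (by positivity)

theorem HasUnitRadius.one_le_radius {L : MonicDiffOp p n} (h : HasUnitRadius L.companion) :
    1 ≤ L.radius := by
  rw [MonicDiffOp.radius, ENNReal.one_le_inv]
  refine ENNReal.le_of_forall_pos_le_add fun ε hε _ => ?_
  have hr1 : (1 : ℝ) < 1 + ε := lt_add_of_pos_right _ hε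
  have hs1 : 1 < √(1 + (ε : ℝ)) := by
    rw [Real.lt_sqrt zero_le_one, one_pow]; exact hr1
  obtain ⟨C, hC, hb⟩ := h _ hs1
  have hbig : ∀ᶠ j in Filter.atTop, C ≤ √(1 + (ε : ℝ)) ^ j :=
    (tendsto_pow_atTop_atTop_of_one_lt hs1).eventually_ge_atTop C
  refine Filter.limsup_le_of_le (h := ?_)
  filter_upwards [hbig, Filter.eventually_gt_atTop 0] with j hj hj0
  have hj0' : (0 : ℝ) < j := by exact_mod_cast hj0
  have he : (1 : ℝ≥0∞) + ε = ENNReal.ofReal (1 + (ε : ℝ)) := by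
    rw [ENNReal.ofReal_add zero_le_one ε.coe_nonneg, ENNReal.ofReal_one, ENNReal.ofReal_coe_nnreal]
  rw [one_div, ENNReal.rpow_inv_le_iff hj0', ENNReal.rpow_natCast, he,
    ← ENNReal.ofReal_pow (by positivity), matNorm_le_ofReal_iff (by positivity)]
  refine (hb j).mono ?_
  calc C * √(1 + (ε : ℝ)) ^ j ≤ √(1 + (ε : ℝ)) ^ j * √(1 + (ε : ℝ)) ^ j := by gcongr
    _ = (1 + (ε : ℝ)) ^ j := by
      rw [← mul_pow, Real.mul_self_sqrt (by positivity)]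

/-! ### Gauss's lemma for differential operators -/

/-- A power series all of whose coefficients belong to `pℤ_p`. -/
def IsSmall (f : ℚ_[p]⟦X⟧) : Prop := ∀ k, ‖PowerSeries.coeff k f‖ < 1

namespace IsSmall

variable {f g : ℚ_[p]⟦X⟧}

theorem add (hf : IsSmall f) (hg : IsSmall g) : IsSmall (f + g) := fun k => by
  rw [map_add]
  exact (IsUltrametricDist.norm_add_le_max _ _).trans_lt (max_lt (hf k) (hg k))

theorem neg (hf : IsSmall f) : IsSmall (-f) := fun k => by
  rw [map_neg, norm_neg]; exact hf k

theorem zero : IsSmall (0 : ℚ_[p]⟦X⟧) := fun k => by simp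

theorem sum {ι : Type*} (s : Finset ι) {f : ι → ℚ_[p]⟦X⟧} (h : ∀ x ∈ s, IsSmall (f x)) :
    IsSmall (∑ x ∈ s, f x) :=
  Finset.sum_induction f IsSmall (fun _ _ => add) zero h

theorem delta (hf : IsSmall f) : IsSmall (delta p f) := fun k => by
  rw [coeff_delta, norm_mul]
  refine (mul_le_of_le_one_left (norm_nonneg _) ?_).trans_lt (hf k)
  simpa using Padic.norm_int_le_one (p := p) (k : ℤ)

end IsSmall

theorem delta_mem_integralSeries {f : ℚ_[p]⟦X⟧} (h : f ∈ integralSeries p) :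
    delta p f ∈ integralSeries p := by
  rw [mem_integralSeries_iff] at h ⊢
  intro k
  rw [coeff_delta, norm_mul]
  refine (mul_le_of_le_one_left (norm_nonneg _) ?_).trans (h k)
  simpa using Padic.norm_int_le_one (p := p) (k : ℤ)

theorem isSmall_map_iff (f : ℤ_[p]⟦X⟧) :
    IsSmall (PowerSeries.map (algebraMap ℤ_[p] ℚ_[p]) f) ↔
      PowerSeries.map (PadicInt.toZMod (p := p)) f = 0 := by
  rw [PowerSeries.ext_iff]
  refine forall_congr' fun k => ?_
  rw [PowerSeries.coeff_map, PowerSeries.coeff_map, map_zero, ← RingHom.mem_ker,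
    PadicInt.ker_toZMod, IsLocalRing.mem_maximalIdeal, PadicInt.mem_nonunits]
  rfl

/-- Reduction modulo `p` maps `ℤ_p[[z]]` to the domain `𝔽_p[[z]]`. -/
theorem isSmall_mul_iff {f g : ℚ_[p]⟦X⟧} (hf : f ∈ integralSeries p) (hg : g ∈ integralSeries p) :
    IsSmall (f * g) ↔ IsSmall f ∨ IsSmall g := by
  obtain ⟨f, rfl⟩ := hf
  obtain ⟨g, rfl⟩ := hg
  rw [← map_mul, isSmall_map_iff, isSmall_map_iff, isSmall_map_iff, map_mul, mul_eq_zero]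

theorem not_isSmall_one : ¬ IsSmall (1 : ℚ_[p]⟦X⟧) := fun h => by
  have := h 0
  simp at this

theorem isSmall_p_smul_iff (f : ℚ_[p]⟦X⟧) :
    IsSmall ((p : ℚ_[p]) • f) ↔ f ∈ integralSeries p := by
  have hp : (0 : ℝ) < p := by exact_mod_cast (Fact.out : p.Prime).pos
  rw [mem_integralSeries_iff]
  refine forall_congr' fun k => ?_
  rw [PowerSeries.coeff_smul, smul_eq_mul, norm_mul, Padic.norm_p, inv_mul_lt_iff₀ hp, mul_one]
  have h := Padic.norm_le_pow_iff_norm_lt_pow_add_one (PowerSeries.coeff k f) 0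
  rw [zpow_zero, zero_add, zpow_one] at h
  exact h.symm

/-- A finite family of bounded series one of which is `1` can be scaled to an integral family
that is nonzero modulo `p`; `i₀` is the largest index of a member nonzero modulo `p`. -/
theorem exists_primitive_scaling {f : ℕ → ℚ_[p]⟦X⟧} (hb : ∀ k, f k ∈ boundedSeries p) {T : ℕ}
    (hT : ∀ k, T < k → f k = 0) {k₁ : ℕ} (h1 : f k₁ = 1) :
    ∃ a i₀ : ℕ, (∀ k, (p : ℚ_[p]) ^ a • f k ∈ integralSeries p) ∧
      ¬ IsSmall ((p : ℚ_[p]) ^ a • f i₀) ∧ ∀ k, i₀ < k → IsSmall ((p : ℚ_[p]) ^ a • f k) := by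
  classical
  have hp1 : (1 : ℝ) < p := by exact_mod_cast (Fact.out : p.Prime).one_lt
  have hex : ∃ a : ℕ, ∀ k, (p : ℚ_[p]) ^ a • f k ∈ integralSeries p := by
    choose C hC using fun k => (mem_boundedSeries_iff (f k)).1 (hb k)
    obtain ⟨a, ha⟩ := pow_unbounded_of_one_lt (∑ k ∈ Finset.range (T + 1), |C k|) hp1
    refine ⟨a, fun k => ?_⟩
    rcases lt_or_ge T k with hk | hk
    · rw [hT k hk, smul_zero]; exact zero_mem _
    · refine (mem_integralSeries_iff _).2 fun l => ?_
      rw [PowerSeries.coeff_smul, smul_eq_mul, norm_mul, norm_pow, Padic.norm_p, inv_pow,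
        inv_mul_le_iff₀ (by positivity), mul_one]
      refine ((hC k l).trans (le_abs_self _)).trans (le_trans ?_ ha.le)
      exact Finset.single_le_sum (f := fun k => |C k|) (fun _ _ => abs_nonneg _)
        (Finset.mem_range.2 (Nat.lt_succ_of_le hk))
  have hprim : ∃ k, ¬ IsSmall ((p : ℚ_[p]) ^ Nat.find hex • f k) := by
    rcases Nat.eq_zero_or_pos (Nat.find hex) with h0 | h0
    · refine ⟨k₁, ?_⟩
      rw [h0, pow_zero, one_smul, h1]
      exact not_isSmall_one
    · by_contra! hcon
      refine Nat.find_min hex (Nat.sub_lt h0 zero_lt_one) fun k => ?_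
      rw [← isSmall_p_smul_iff, smul_smul, ← pow_succ',
        Nat.sub_add_cancel (show 1 ≤ Nat.find hex from h0)]
      exact hcon k
  have hle : ∀ k, ¬ IsSmall ((p : ℚ_[p]) ^ Nat.find hex • f k) → k ≤ T := by
    intro k hk
    by_contra! hcon
    exact hk (by rw [hT k hcon, smul_zero]; exact IsSmall.zero)
  obtain ⟨k, hk⟩ := hprim
  refine ⟨Nat.find hex,
    Nat.findGreatest (fun k => ¬ IsSmall ((p : ℚ_[p]) ^ Nat.find hex • f k)) T,
    Nat.find_spec hex, ?_, fun k' hk' => ?_⟩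
  · exact Nat.findGreatest_spec (P := fun k => ¬ IsSmall ((p : ℚ_[p]) ^ Nat.find hex • f k))
      (hle k hk) hk
  · by_contra hcon
    exact Nat.findGreatest_is_greatest hk' (hle k' hcon) hcon

/-- Left multiplication by `δ` on differential operators `∑_k f_k δ^k`, given by their sequences
of coefficients. -/
noncomputable def deltaMul (f : ℕ → ℚ_[p]⟦X⟧) : ℕ → ℚ_[p]⟦X⟧
  | 0 => delta p (f 0)
  | k + 1 => delta p (f (k + 1)) + f k

theorem deltaMul_add (f g : ℕ → ℚ_[p]⟦X⟧) : deltaMul (f + g) = deltaMul f + deltaMul g := by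
  funext k
  cases k with
  | zero => simp [deltaMul]
  | succ k => simp only [deltaMul, Pi.add_apply, map_add]; abel

theorem deltaMul_smul (a : ℚ_[p]⟦X⟧) (f : ℕ → ℚ_[p]⟦X⟧) :
    deltaMul (a • f) = a • deltaMul f + delta p a • f := by
  funext k
  cases k with
  | zero => simp [deltaMul, mul_comm]
  | succ k =>
    simp only [deltaMul, Pi.add_apply, Pi.smul_apply, smul_eq_mul, Derivation.leibniz, mul_add]
    rw [mul_comm (f (k + 1))]
    abel

theorem deltaMul_const_smul (c : ℚ_[p]) (f : ℕ → ℚ_[p]⟦X⟧) :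
    deltaMul (c • f) = c • deltaMul f := by
  funext k
  cases k with
  | zero => simp [deltaMul]
  | succ k => simp [deltaMul]

theorem deltaMul_sum (q : ℕ → ℚ_[p]⟦X⟧) (f : ℕ → ℕ → ℚ_[p]⟦X⟧) (s : Finset ℕ) :
    deltaMul (∑ j ∈ s, q j • f j) =
      ∑ j ∈ s, q j • deltaMul (f j) + ∑ j ∈ s, delta p (q j) • f j := by
  classical
  induction s using Finset.induction_on with
  | empty =>
    simp only [Finset.sum_empty, add_zero]
    funext k
    cases k <;> simp [deltaMul]
  | insert a s ha ih =>
    rw [Finset.sum_insert ha, Finset.sum_insert ha, Finset.sum_insert ha, deltaMul_add, ih,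
      deltaMul_smul]
    abel

theorem iterate_deltaMul_const_smul (c : ℚ_[p]) (f : ℕ → ℚ_[p]⟦X⟧) (j : ℕ) :
    deltaMul^[j] (c • f) = c • deltaMul^[j] f := by
  induction j with
  | zero => rfl
  | succ j ih => rw [Function.iterate_succ_apply', ih, deltaMul_const_smul,
      Function.iterate_succ_apply']

/-- The reduction modulo `p` of `δ^j f` has leading index `i₀ + j` if that of `f` has leading
index `i₀`. -/
theorem iterate_deltaMul_leading {f : ℕ → ℚ_[p]⟦X⟧} {i₀ : ℕ}
    (hint : ∀ k, f k ∈ integralSeries p) (h0 : ¬ IsSmall (f i₀)) (hgt : ∀ k, i₀ < k → IsSmall (f k))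
    (j : ℕ) :
    (∀ k, deltaMul^[j] f k ∈ integralSeries p) ∧ ¬ IsSmall (deltaMul^[j] f (i₀ + j)) ∧
      ∀ k, i₀ + j < k → IsSmall (deltaMul^[j] f k) := by
  induction j with
  | zero => exact ⟨hint, h0, hgt⟩
  | succ j ih =>
    obtain ⟨ih1, ih2, ih3⟩ := ih
    rw [Function.iterate_succ_apply']
    refine ⟨fun k => ?_, fun hsm => ih2 ?_, fun k hk => ?_⟩
    · cases k with
      | zero => exact delta_mem_integralSeries (ih1 0)
      | succ k => exact add_mem (delta_mem_integralSeries (ih1 _)) (ih1 k)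
    · have h1 := (ih3 (i₀ + j + 1) (Nat.lt_succ_self _)).delta
      have h2 := hsm.add h1.neg
      rw [← add_assoc] at h2
      simpa [deltaMul] using h2
    · cases k with
      | zero => omega
      | succ k => exact (ih3 (k + 1) (by omega)).delta.add (ih3 k (by omega))

/-- Gauss's lemma: if `(∑_j q_j δ^j) (∑_k f_k δ^k)` is integral, where both factors are bounded
and have a coefficient `1`, then the right factor is integral. -/
theorem mem_integralSeries_of_product {f q : ℕ → ℚ_[p]⟦X⟧} (hf : ∀ k, f k ∈ boundedSeries p)
    (hq : ∀ j, q j ∈ boundedSeries p) {n t k₁ j₁ : ℕ} (hfn : ∀ k, n < k → f k = 0)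
    (hqt : ∀ j, t ≤ j → q j = 0) (hf1 : f k₁ = 1) (hq1 : q j₁ = 1)
    (hP : ∀ k, ∑ j ∈ Finset.range t, q j * deltaMul^[j] f k ∈ integralSeries p) :
    ∀ k, f k ∈ integralSeries p := by
  obtain ⟨a, i₀, ha, ha0, hagt⟩ := exists_primitive_scaling hf hfn hf1
  obtain ⟨b, j₀, hb, hb0, hbgt⟩ :=
    exists_primitive_scaling hq (T := t) (fun j hj => hqt j hj.le) hq1
  have hlead := iterate_deltaMul_leading (f := (p : ℚ_[p]) ^ a • f) ha ha0 hagt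
  have hj₀ : j₀ ∈ Finset.range t := by
    rw [Finset.mem_range]
    by_contra! hcon
    exact hb0 (by rw [hqt j₀ hcon, smul_zero]; exact IsSmall.zero)
  have hsum : (p : ℚ_[p]) ^ (a + b) • ∑ j ∈ Finset.range t, q j * deltaMul^[j] f (i₀ + j₀) =
      ∑ j ∈ Finset.range t,
        ((p : ℚ_[p]) ^ b • q j) * deltaMul^[j] ((p : ℚ_[p]) ^ a • f) (i₀ + j₀) := by
    rw [Finset.smul_sum]
    refine Finset.sum_congr rfl fun j _ => ?_
    rw [iterate_deltaMul_const_smul, Pi.smul_apply, smul_mul_smul_comm, pow_add, mul_comm]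
  have hnot : ¬ IsSmall ((p : ℚ_[p]) ^ (a + b) •
      ∑ j ∈ Finset.range t, q j * deltaMul^[j] f (i₀ + j₀)) := by
    rw [hsum, ← Finset.add_sum_erase _ _ hj₀]
    intro hsm
    have hrest : IsSmall (∑ j ∈ (Finset.range t).erase j₀,
        ((p : ℚ_[p]) ^ b • q j) * deltaMul^[j] ((p : ℚ_[p]) ^ a • f) (i₀ + j₀)) := by
      refine IsSmall.sum _ fun j hj => (isSmall_mul_iff (hb j) ((hlead j).1 _)).2 ?_
      rcases lt_trichotomy j j₀ with hlt | heq | hgt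
      · exact Or.inr ((hlead j).2.2 _ (by omega))
      · exact absurd heq (Finset.ne_of_mem_erase hj)
      · exact Or.inl (hbgt j hgt)
    have h1 := hsm.add hrest.neg
    rw [add_neg_cancel_right, isSmall_mul_iff (hb j₀) ((hlead j₀).1 _)] at h1
    exact h1.elim hb0 (hlead j₀).2.1
  have hab : a + b = 0 := by
    by_contra hne
    obtain ⟨m, hm⟩ := Nat.exists_eq_succ_of_ne_zero hne
    refine hnot ?_
    rw [hm, pow_succ', mul_smul, isSmall_p_smul_iff, mem_integralSeries_iff]
    intro k
    rw [PowerSeries.coeff_smul, smul_eq_mul, norm_mul, norm_pow]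
    exact mul_le_one₀ (pow_le_one₀ (norm_nonneg _) Padic.norm_p_lt_one.le) (norm_nonneg _)
      ((mem_integralSeries_iff _).1 (hP _) k)
  intro k
  have h := ha k
  rwa [show a = 0 by omega, pow_zero, one_smul] at h

/-! ### Division of `δ (δ - 1) ⋯ (δ - s + 1)` by an operator -/

/-- The sequence of coefficients of a monic operator of order `n`. -/
noncomputable def MonicDiffOp.coeffSeq (L : MonicDiffOp p n) (k : ℕ) : ℚ_[p]⟦X⟧ :=
  if h : k < n then L.coeff ⟨k, h⟩ else if k = n then 1 else 0

/-- The sequence of coefficients of the operator `∑_i v_i δ^i` of order less than `n`. -/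
noncomputable def rowSeq (v : Fin n → ℚ_[p]⟦X⟧) (k : ℕ) : ℚ_[p]⟦X⟧ :=
  if h : k < n then v ⟨k, h⟩ else 0

/-- The sequence of coefficients of the operator `δ (δ - 1) ⋯ (δ - s + 1)`. -/
noncomputable def fallingOp (p : ℕ) [Fact p.Prime] : ℕ → ℕ → ℚ_[p]⟦X⟧
  | 0 => fun k => if k = 0 then 1 else 0
  | s + 1 => deltaMul (fallingOp p s) - (s : ℚ_[p]) • fallingOp p s

theorem fallingOp_spec (s : ℕ) :
    (∀ k, fallingOp p s k ∈ integralSeries p) ∧ fallingOp p s s = 1 ∧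
      ∀ k, s < k → fallingOp p s k = 0 := by
  induction s with
  | zero =>
    refine ⟨fun k => ?_, by simp [fallingOp], fun k hk => by simp [fallingOp]; omega⟩
    simp only [fallingOp]
    split_ifs
    exacts [one_mem _, zero_mem _]
  | succ s ih =>
    obtain ⟨ih1, ih2, ih3⟩ := ih
    refine ⟨fun k => ?_, ?_, fun k hk => ?_⟩
    · refine sub_mem ?_ ?_
      · cases k with
        | zero => exact delta_mem_integralSeries (ih1 0)
        | succ k => exact add_mem (delta_mem_integralSeries (ih1 _)) (ih1 k)
      · rw [Pi.smul_apply, Nat.cast_smul_eq_nsmul]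
        exact nsmul_mem (ih1 k) s
    · simp [fallingOp, deltaMul, ih2, ih3 (s + 1) (Nat.lt_succ_self s)]
    · obtain ⟨k, rfl⟩ := Nat.exists_eq_succ_of_ne_zero (by omega : k ≠ 0)
      simp [fallingOp, deltaMul, ih3 (k + 1) (by omega), ih3 k (by omega)]

theorem iterate_deltaMul_coeffSeq (L : MonicDiffOp p n) (j : ℕ) :
    deltaMul^[j] L.coeffSeq (n + j) = 1 ∧ ∀ k, n + j < k → deltaMul^[j] L.coeffSeq k = 0 := by
  induction j with
  | zero =>
    refine ⟨by simp [MonicDiffOp.coeffSeq], fun k hk => ?_⟩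
    simp only [Function.iterate_zero, id, MonicDiffOp.coeffSeq]
    rw [dif_neg (by omega), if_neg (by omega)]
  | succ j ih =>
    obtain ⟨ih1, ih2⟩ := ih
    rw [Function.iterate_succ_apply']
    refine ⟨?_, fun k hk => ?_⟩
    · rw [← add_assoc]
      simp [deltaMul, ih1, ih2 (n + j + 1) (Nat.lt_succ_self _)]
    · obtain ⟨k, rfl⟩ := Nat.exists_eq_succ_of_ne_zero (by omega : k ≠ 0)
      simp [deltaMul, ih2 (k + 1) (by omega), ih2 k (by omega)]

/-- Modulo left multiples of `L`, the operator `δ ∘ ∑_i v_i δ^i` is given by the row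
`δ v + v B`, where `B` is the companion matrix of `L`. -/
theorem deltaMul_rowSeq (hn : 1 ≤ n) (L : MonicDiffOp p n) (v : Fin n → ℚ_[p]⟦X⟧) :
    deltaMul (rowSeq v) =
      v ⟨n - 1, by omega⟩ • L.coeffSeq +
        rowSeq fun j => delta p (v j) + ∑ i, v i * L.companion i j := by
  have hcomp : ∀ j : Fin n, ∑ i, v i * L.companion i j =
      (if h : 0 < (j : ℕ) then v ⟨j - 1, by omega⟩ else 0) - v ⟨n - 1, by omega⟩ * L.coeff j := by
    intro j
    have hlast : ∀ i : Fin n, v i * L.companion i j =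
        (if (j : ℕ) = i + 1 then v i else 0) -
          (if i = ⟨n - 1, by omega⟩ then v i * L.coeff j else 0) := by
      intro i
      simp only [MonicDiffOp.companion, Matrix.of_apply, Fin.ext_iff]
      have hj := j.2
      by_cases h1 : (i : ℕ) + 1 = n
      · rw [if_pos h1, if_neg (by omega), if_pos (by omega)]; ring
      · rw [if_neg h1, if_neg (c := (i : ℕ) = n - 1) (by omega)]
        split_ifs <;> simp
    simp only [hlast, Finset.sum_sub_distrib, Finset.sum_ite_eq', Finset.mem_univ, if_true]
    congr 1
    split_ifs with h
    · rw [Finset.sum_eq_single ⟨j - 1, by omega⟩]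
      · rw [if_pos (by simp only; omega)]
      · exact fun i _ hi => if_neg fun h' => hi (Fin.ext (by simp only; omega))
      · simp
    · exact Finset.sum_eq_zero fun i _ => if_neg (by omega)
  funext k
  simp only [Pi.add_apply, Pi.smul_apply, smul_eq_mul, hcomp]
  cases k with
  | zero =>
    simp only [deltaMul, rowSeq, MonicDiffOp.coeffSeq, dif_pos (show 0 < n from hn)]
    simp
  | succ k =>
    simp only [deltaMul, rowSeq, MonicDiffOp.coeffSeq]
    rcases lt_trichotomy (k + 1) n with h | h | h
    · simp [h, (Nat.lt_succ_self k).trans h]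
      ring
    · have hk : k < n := by omega
      have hk' : (⟨k, hk⟩ : Fin n) = ⟨n - 1, by omega⟩ := Fin.ext (by simp only; omega)
      simp [h, hk, hk']
    · have hk : ¬ k < n := by omega
      have hk1 : ¬ k + 1 < n := by omega
      simp [hk, hk1, h.ne']

theorem rowSeq_sub_smul (u v : Fin n → ℚ_[p]⟦X⟧) (c : ℚ_[p]) :
    rowSeq (fun j => u j - c • v j) = rowSeq u - c • rowSeq v := by
  funext k
  simp only [rowSeq, Pi.sub_apply, Pi.smul_apply]
  split_ifs <;> simp

theorem genericMatrix_row (A : SeriesMat p n) (s : ℕ) (i : Fin n) :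
    genericMatrix A (s + 1) i = fun j => (delta p (genericMatrix A s i j) +
      ∑ x, genericMatrix A s i x * A x j) - (s : ℚ_[p]) • genericMatrix A s i j := by
  funext j
  rw [genericMatrix, mul_sub, mul_smul_comm, mul_one, Matrix.add_apply, Matrix.sub_apply,
    Matrix.map_apply, Matrix.smul_apply, Matrix.mul_apply, add_sub_assoc]

theorem fallingOp_succ_of_eq (hn : 1 ≤ n) (L : MonicDiffOp p n) (s : ℕ) {f : ℕ → ℚ_[p]⟦X⟧}
    (h : fallingOp p s = f + rowSeq (genericMatrix L.companion s ⟨0, hn⟩)) :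
    fallingOp p (s + 1) = (deltaMul f - (s : ℚ_[p]) • f) +
      genericMatrix L.companion s ⟨0, hn⟩ ⟨n - 1, by omega⟩ • L.coeffSeq +
        rowSeq (genericMatrix L.companion (s + 1) ⟨0, hn⟩) := by
  rw [fallingOp, h, deltaMul_add, deltaMul_rowSeq hn L, genericMatrix_row, rowSeq_sub_smul,
    smul_add]
  abel

theorem fallingOp_eq_rowSeq (hn : 1 ≤ n) (L : MonicDiffOp p n) {s : ℕ} (hs : s < n) :
    fallingOp p s = rowSeq (genericMatrix L.companion s ⟨0, hn⟩) := by
  induction s with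
  | zero =>
    funext k
    simp only [fallingOp, rowSeq, genericMatrix, Matrix.one_apply, Fin.ext_iff]
    split_ifs <;> first | rfl | omega
  | succ s ih =>
    have ih := ih (by omega)
    have hlast : genericMatrix L.companion s ⟨0, hn⟩ ⟨n - 1, by omega⟩ = 0 := by
      have h1 := congrFun ih (n - 1)
      rw [(fallingOp_spec s).2.2 _ (by omega), rowSeq, dif_pos (by omega)] at h1
      exact h1.symm
    have h2 := fallingOp_succ_of_eq hn L s (f := 0) (by rw [ih, zero_add])
    have h3 : deltaMul (0 : ℕ → ℚ_[p]⟦X⟧) = 0 := by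
      have := deltaMul_const_smul (0 : ℚ_[p]) 0
      simpa using this
    rw [h2, hlast, h3]
    simp

/-- Right division of `δ (δ - 1) ⋯ (δ - s + 1)` by `L`: the remainder is the first row of the
matrix `A_s` of the generic solution. -/
theorem exists_fallingOp_division (hn : 1 ≤ n) (L : MonicDiffOp p n)
    (hb : ∀ s i j, genericMatrix L.companion s i j ∈ boundedSeries p) (t : ℕ) :
    ∃ q : ℕ → ℚ_[p]⟦X⟧, (∀ j, q j ∈ boundedSeries p) ∧ (∀ j, t ≤ j → q j = 0) ∧
      fallingOp p (n - 1 + t) = ∑ j ∈ Finset.range t, q j • deltaMul^[j] L.coeffSeq +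
        rowSeq (genericMatrix L.companion (n - 1 + t) ⟨0, hn⟩) := by
  have hdelta : ∀ f ∈ boundedSeries p, delta p f ∈ boundedSeries p := by
    intro f hf
    obtain ⟨C, hC⟩ := (mem_boundedSeries_iff f).1 hf
    refine (mem_boundedSeries_iff _).2 ⟨C, fun k => ?_⟩
    rw [coeff_delta, norm_mul]
    refine (mul_le_of_le_one_left (norm_nonneg _) ?_).trans (hC k)
    simpa using Padic.norm_int_le_one (p := p) (k : ℤ)
  induction t with
  | zero =>
    refine ⟨0, fun _ => zero_mem _, fun _ _ => rfl, ?_⟩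
    rw [Finset.range_zero, Finset.sum_empty, zero_add]
    exact fallingOp_eq_rowSeq hn L (by omega)
  | succ t ih =>
    obtain ⟨q, hq, hqt, heq⟩ := ih
    set s := n - 1 + t with hs
    set v := genericMatrix L.companion s ⟨0, hn⟩ ⟨n - 1, by omega⟩ with hv
    let r : ℕ → ℚ_[p]⟦X⟧ := fun j => if j = 0 then v else q (j - 1)
    refine ⟨fun j => r j + (delta p (q j) - (s : ℚ_[p]) • q j), fun j => ?_, fun j hj => ?_, ?_⟩
    · refine add_mem ?_ (sub_mem (hdelta _ (hq j)) ?_)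
      · simp only [r]
        split_ifs
        exacts [hb _ _ _, hq _]
      · rw [Nat.cast_smul_eq_nsmul]
        exact nsmul_mem (hq j) s
    · simp only [r]
      rw [if_neg (by omega), hqt j (by omega), hqt (j - 1) (by omega)]
      simp
    · have h1 := fallingOp_succ_of_eq hn L s heq
      rw [← add_assoc, ← hs, h1, ← hv, deltaMul_sum]
      congr 1
      simp only [add_smul, sub_smul, Finset.sum_add_distrib, Finset.sum_sub_distrib]
      rw [Finset.sum_range_succ' (fun j => r j • deltaMul^[j] L.coeffSeq),
        Finset.sum_range_succ (fun j => delta p (q j) • deltaMul^[j] L.coeffSeq),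
        Finset.sum_range_succ (fun j => ((s : ℚ_[p]) • q j) • deltaMul^[j] L.coeffSeq),
        hqt t le_rfl]
      simp only [r, Nat.succ_ne_zero, if_false, Nat.add_sub_cancel, if_true,
        Function.iterate_succ_apply', Function.iterate_zero, id, map_zero, smul_zero, zero_smul,
        add_zero, Finset.smul_sum, smul_assoc]
      abel

/-- An operator whose generic solution has radius of convergence at least `1` is integral: it
divides a monic integral operator, since the remainders of the operators
`δ (δ - 1) ⋯ (δ - s + 1)` tend to `0`. -/
theorem HasUnitRadius.isIntegral (hn : 1 ≤ n) {L : MonicDiffOp p n}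
    (h : HasUnitRadius L.companion) : L.IsIntegral := by
  have hp : p.Prime := Fact.out
  have hp2 : (2 : ℝ) ≤ p := by exact_mod_cast hp.two_le
  have hgen : ∀ q C : ℝ, ∀ s, CoeffBound (C * q ^ s)
      ((s.factorial : ℚ_[p])⁻¹ • genericMatrix L.companion s) →
      CoeffBound (‖(s.factorial : ℚ_[p])‖ * (C * q ^ s)) (genericMatrix L.companion s) := by
    intro q C s hs
    have h0 : (s.factorial : ℚ_[p]) ≠ 0 := by exact_mod_cast s.factorial_ne_zero
    have := hs.smul (s.factorial : ℚ_[p])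
    rwa [smul_smul, mul_inv_cancel₀ h0, one_smul] at this
  have hb : ∀ s i j, genericMatrix L.companion s i j ∈ boundedSeries p := by
    intro s i j
    obtain ⟨C, _, hC⟩ := h 2 one_lt_two
    exact (mem_boundedSeries_iff _).2 ⟨_, fun k => hgen 2 C s (hC s) i j k⟩
  obtain ⟨t, ht⟩ : ∃ t, CoeffBound 1 (genericMatrix L.companion (n - 1 + (t + 1))) := by
    -- for `s = p u` and `q ^ p = 3 / 2`, the bound `|s!| C q ^ s` is at most `C (3 / 4) ^ u`
    have hppos : 0 < (p : ℝ)⁻¹ := by positivity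
    have hq1 : 1 < (3 / 2 : ℝ) ^ (p : ℝ)⁻¹ := Real.one_lt_rpow (by norm_num) hppos
    have hqp : ((3 / 2 : ℝ) ^ (p : ℝ)⁻¹) ^ p = 3 / 2 :=
      Real.rpow_inv_natCast_pow (by norm_num) hp.ne_zero
    obtain ⟨C, hC0, hC⟩ := h _ hq1
    have hlim : Filter.Tendsto (fun u : ℕ => C * (3 / 4 : ℝ) ^ u) Filter.atTop (nhds 0) := by
      simpa using (tendsto_pow_atTop_nhds_zero_of_lt_one (by norm_num : (0 : ℝ) ≤ 3 / 4)
        (by norm_num)).const_mul C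
    obtain ⟨u, hu, hun⟩ := ((hlim.eventually (gt_mem_nhds zero_lt_one)).and
      (Filter.eventually_ge_atTop n)).exists
    have hpu : n ≤ p * u := hun.trans (Nat.le_mul_of_pos_left u hp.pos)
    refine ⟨p * u - n, ?_⟩
    rw [show n - 1 + (p * u - n + 1) = p * u by omega]
    refine (hgen _ C (p * u) (hC _)).mono (le_trans ?_ hu.le)
    rw [pow_mul, hqp]
    have hf := norm_factorial_le (p := p) (p * u)
    rw [Nat.mul_div_cancel_left u hp.pos] at hf
    calc ‖((p * u).factorial : ℚ_[p])‖ * (C * (3 / 2) ^ u)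
        ≤ ((p : ℝ)⁻¹) ^ u * (C * (3 / 2) ^ u) := by gcongr
      _ ≤ ((2 : ℝ)⁻¹) ^ u * (C * (3 / 2) ^ u) := by gcongr
      _ = C * ((2 : ℝ)⁻¹ * (3 / 2)) ^ u := by rw [mul_pow]; ring
      _ = C * (3 / 4) ^ u := by norm_num
  obtain ⟨q, hq, hqt, heq⟩ := exists_fallingOp_division hn L hb (t + 1)
  have hP : ∀ k, ∑ j ∈ Finset.range (t + 1), q j * deltaMul^[j] L.coeffSeq k =
      fallingOp p (n - 1 + (t + 1)) k -
        rowSeq (genericMatrix L.companion (n - 1 + (t + 1)) ⟨0, hn⟩) k := by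
    intro k
    rw [heq]
    simp [Finset.sum_apply]
  have hqt1 : q t = 1 := by
    have h1 := hP (n + t)
    rw [Finset.sum_range_succ, (iterate_deltaMul_coeffSeq L t).1, mul_one,
      Finset.sum_eq_zero fun j hj => by
        rw [(iterate_deltaMul_coeffSeq L j).2 _ (by have := Finset.mem_range.1 hj; omega),
          mul_zero],
      zero_add, show n - 1 + (t + 1) = n + t by omega, (fallingOp_spec (n + t)).2.1, rowSeq,
      dif_neg (by omega), sub_zero] at h1
    exact h1
  have hcomp : ∀ j : Fin n, L.coeff j ∈ boundedSeries p := by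
    intro j
    have h1 := hb 1 ⟨n - 1, by omega⟩ j
    have h2 : genericMatrix L.companion 1 = L.companion := by
      have h3 : (1 : SeriesMat p n).map (delta p) = 0 := by
        simpa using map_delta_const (1 : ConstMat p n)
      simp [genericMatrix, h3]
    rw [h2] at h1
    simp only [MonicDiffOp.companion, Matrix.of_apply] at h1
    rw [if_pos (by omega)] at h1
    simpa using neg_mem h1
  have hint : ∀ k, L.coeffSeq k ∈ integralSeries p := by
    refine mem_integralSeries_of_product (n := n) (t := t + 1) (k₁ := n) (j₁ := t) (fun k => ?_) hq
      (fun k hk => ?_) hqt ?_ hqt1 fun k => ?_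
    · simp only [MonicDiffOp.coeffSeq]
      split_ifs
      exacts [hcomp _, one_mem _, zero_mem _]
    · exact (iterate_deltaMul_coeffSeq L 0).2 k hk
    · exact (iterate_deltaMul_coeffSeq L 0).1
    · rw [hP]
      refine sub_mem ((fallingOp_spec _).1 k) ?_
      simp only [rowSeq]
      split_ifs
      exacts [(coeffBound_one_iff.1 ht) _ _, zero_mem _]
  intro i
  have := hint i
  rwa [MonicDiffOp.coeffSeq, dif_pos i.2] at this

/-! ### Iteration of the antecedent -/

/-- The matrix `diag(1, p^(-m), …) Λ_p^m(Y) diag(1, p^m, …)`. -/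
noncomputable def iterAntecedent (m : ℕ) (Y : SeriesMat p n) : SeriesMat p n :=
  powDiag n ((p : ℚ_[p]) ^ m)⁻¹ * Y.map ((cartier p)^[m]) * powDiag n ((p : ℚ_[p]) ^ m)

theorem iterAntecedent_zero (Y : SeriesMat p n) : iterAntecedent 0 Y = Y := by
  simp [iterAntecedent, powDiag_one]

theorem map_cartier_mul_const (M : SeriesMat p n) (N : ConstMat p n) :
    (M * N.map PowerSeries.C).map (cartier p) = M.map (cartier p) * N.map PowerSeries.C :=
  seriesMat_ext fun k => by
    rw [coeffMat_cartier, coeffMat_mul_const, coeffMat_mul_const, coeffMat_cartier]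

theorem map_cartier_const_mul (M : SeriesMat p n) (N : ConstMat p n) :
    (N.map PowerSeries.C * M).map (cartier p) = N.map PowerSeries.C * M.map (cartier p) :=
  seriesMat_ext fun k => by
    rw [coeffMat_cartier, coeffMat_const_mul, coeffMat_const_mul, coeffMat_cartier]

theorem map_cartier_iterate_succ (m : ℕ) (Y : SeriesMat p n) :
    Y.map ((cartier p)^[m + 1]) = (Y.map ((cartier p)^[m])).map (cartier p) := by
  refine Matrix.ext fun i j => ?_
  simp only [Matrix.map_apply, Function.iterate_succ_apply']

theorem map_cartier_iterAntecedent (m : ℕ) (Y : SeriesMat p n) :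
    (iterAntecedent m Y).map (cartier p) =
      powDiag n ((p : ℚ_[p]) ^ m)⁻¹ * Y.map ((cartier p)^[m + 1]) *
        powDiag n ((p : ℚ_[p]) ^ m) := by
  rw [iterAntecedent, powDiag_eq_map, powDiag_eq_map, map_cartier_mul_const,
    map_cartier_const_mul, map_cartier_iterate_succ]

theorem iterAntecedent_succ (m : ℕ) (Y : SeriesMat p n) :
    iterAntecedent (m + 1) Y = antecedent (iterAntecedent m Y) := by
  have h1 : powDiag n ((p : ℚ_[p]) ^ (m + 1))⁻¹ =
      powDiag n (p : ℚ_[p])⁻¹ * powDiag n ((p : ℚ_[p]) ^ m)⁻¹ := by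
    rw [powDiag_mul, pow_succ', mul_inv]
  have h2 : powDiag n ((p : ℚ_[p]) ^ (m + 1)) =
      powDiag n ((p : ℚ_[p]) ^ m) * powDiag n (p : ℚ_[p]) := by
    rw [powDiag_mul, pow_succ]
  rw [antecedent, map_cartier_iterAntecedent, iterAntecedent, h1, h2]
  simp only [mul_assoc]

theorem evalZero_iterAntecedent (m : ℕ) {Y : SeriesMat p n} (h0 : evalZero Y = 1) :
    evalZero (iterAntecedent m Y) = 1 := by
  induction m with
  | zero => rw [iterAntecedent_zero, h0]
  | succ m ih => rw [iterAntecedent_succ, evalZero_antecedent ih]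

theorem evalZero_map_cartier_iterate (m : ℕ) (Y : SeriesMat p n) :
    evalZero (Y.map ((cartier p)^[m])) = evalZero Y := by
  induction m with
  | zero => simp
  | succ m ih =>
    rw [map_cartier_iterate_succ, evalZero_eq_coeffMat, coeffMat_cartier, zero_mul,
      ← evalZero_eq_coeffMat, ih]

theorem substFrob_inv (m : ℕ) {M : SeriesMat p n} (h : IsUnit M) :
    substFrob p m M⁻¹ = (substFrob p m M)⁻¹ :=
  (Matrix.inv_eq_right_inv (by rw [← substFrob_mul, mul_inv_of_isUnit h, substFrob_one])).symm

theorem substFrob_powDiag (m : ℕ) (c : ℚ_[p]) :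
    substFrob p m (powDiag n c) = powDiag n c := by
  rw [powDiag_eq_map, substFrob_const]

theorem powDiag_conj_inv {c : ℚ_[p]} (hc : c ≠ 0) {M : SeriesMat p n} (h : IsUnit M) :
    (powDiag n c⁻¹ * M * powDiag n c)⁻¹ = powDiag n c⁻¹ * M⁻¹ * powDiag n c := by
  apply Matrix.inv_eq_right_inv
  calc _ = powDiag n c⁻¹ * (M * ((powDiag n c * powDiag n c⁻¹) * M⁻¹)) * powDiag n c := by
        simp only [mul_assoc]
    _ = 1 := by
      rw [powDiag_mul_inv hc, one_mul, mul_inv_of_isUnit h, mul_one, powDiag_inv_mul hc]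

theorem isUnit_substFrob_cartier (m k : ℕ) {Y : SeriesMat p n} (h0 : evalZero Y = 1) :
    IsUnit (substFrob p m (Y.map ((cartier p)^[k]))) :=
  isUnit_of_evalZero_eq_one (by rw [evalZero_substFrob, evalZero_map_cartier_iterate, h0])

theorem hMatrix_zero {Y : SeriesMat p n} (h0 : evalZero Y = 1) : hMatrix 0 Y = 1 := by
  have h1 : Y.map ((cartier p)^[0]) = Y := by
    refine Matrix.ext fun i j => ?_
    rfl
  rw [hMatrix, h1, substFrob_zero, mul_inv_of_isUnit (isUnit_of_evalZero_eq_one h0), pow_zero,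
    powDiag_one, mul_one]

theorem hMatrix_one {Y : SeriesMat p n} (h0 : evalZero Y = 1) :
    hMatrix 1 Y = (frobMat Y)⁻¹ * powDiag n (p : ℚ_[p]) := by
  have hu := isUnit_of_evalZero_eq_one h0
  rw [hMatrix, frobMat, Matrix.mul_inv_rev,
    Matrix.nonsing_inv_nonsing_inv _ ((Matrix.isUnit_iff_isUnit_det _).1 hu), pow_one,
    Function.iterate_one]

/-- The cocycle relation of the matrices `H_m`. -/
theorem hMatrix_succ (m : ℕ) {Y : SeriesMat p n} (h0 : evalZero Y = 1) :
    hMatrix (m + 1) Y = hMatrix m Y * substFrob p m (hMatrix 1 (iterAntecedent m Y)) := by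
  have hpm : (p : ℚ_[p]) ^ m ≠ 0 := pow_ne_zero _ natCast_p_ne_zero
  set D := powDiag n ((p : ℚ_[p]) ^ m) with hD
  set E := powDiag n ((p : ℚ_[p]) ^ m)⁻¹ with hE
  set W := substFrob p m (Y.map ((cartier p)^[m])) with hW
  set W' := substFrob p (m + 1) (Y.map ((cartier p)^[m + 1])) with hW'
  have hWu : IsUnit W := isUnit_substFrob_cartier m m h0
  have hW'u : IsUnit W' := isUnit_substFrob_cartier (m + 1) (m + 1) h0
  have hDE : D * E = 1 := powDiag_mul_inv hpm
  have h1 : substFrob p m (iterAntecedent m Y) = E * W * D := by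
    rw [iterAntecedent, substFrob_mul, substFrob_mul, substFrob_powDiag, substFrob_powDiag]
  have h2 : substFrob p m (substFrob p 1 ((iterAntecedent m Y).map ((cartier p)^[1])))⁻¹ =
      E * W'⁻¹ * D := by
    have h3 : substFrob p (m + 1) ((iterAntecedent m Y).map (cartier p)) = E * W' * D := by
      rw [map_cartier_iterAntecedent, substFrob_mul, substFrob_mul, substFrob_powDiag,
        substFrob_powDiag]
    rw [substFrob_inv _ (isUnit_substFrob_cartier 1 1 (evalZero_iterAntecedent m h0)),
      substFrob_substFrob, Function.iterate_one, h3, hE, hD, powDiag_conj_inv hpm hW'u]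
  rw [hMatrix, hMatrix, hMatrix, substFrob_mul, substFrob_mul, h1, h2, substFrob_powDiag, pow_one,
    ← hW, ← hW', ← hD]
  have h5 : powDiag n ((p : ℚ_[p]) ^ (m + 1)) = D * powDiag n (p : ℚ_[p]) := by
    rw [hD, powDiag_mul, pow_succ]
  calc Y * W'⁻¹ * powDiag n ((p : ℚ_[p]) ^ (m + 1))
      = Y * (W⁻¹ * W) * W'⁻¹ * (D * powDiag n (p : ℚ_[p])) := by
        rw [inv_mul_of_isUnit hWu, mul_one, h5]
    _ = Y * W⁻¹ * (D * E) * W * (D * E) * W'⁻¹ * (D * powDiag n (p : ℚ_[p])) := by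
        rw [hDE]; simp only [mul_assoc, one_mul]
    _ = Y * W⁻¹ * D * (E * W * D * (E * W'⁻¹ * D) * powDiag n (p : ℚ_[p])) := by
        simp only [mul_assoc]

theorem coeffBound_companion {L : MonicDiffOp p n} (h : L.IsIntegral) :
    CoeffBound 1 L.companion := by
  rw [coeffBound_one_iff]
  intro i j
  simp only [MonicDiffOp.companion, Matrix.of_apply]
  split_ifs
  exacts [neg_mem (h j), one_mem _, zero_mem _]

/-- Iteration of the antecedent: the operator `L_m`, with a bounded inverse of `H_m`. -/
theorem exists_iterated_antecedent (hn : 1 ≤ n) {L : MonicDiffOp p n} (hint : L.IsIntegral)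
    (hMUM : L.IsMUM) (hr : HasUnitRadius L.companion) {Y : SeriesMat p n}
    (hY : IsLogFreeSolution L.companion (shiftMat p n) Y) (h0 : evalZero Y = 1) (m : ℕ) :
    ∃ Lm : MonicDiffOp p n, Lm.IsIntegral ∧ Lm.IsMUM ∧ HasUnitRadius Lm.companion ∧
      IsLogFreeSolution Lm.companion (shiftMat p n) (iterAntecedent m Y) ∧
      CoeffBound 1 (hMatrix m Y) ∧
      ∃ (c : ℝ) (G : SeriesMat p n), 0 ≤ c ∧ CoeffBound c G ∧ hMatrix m Y * G = 1 := by
  induction m with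
  | zero =>
    refine ⟨L, hint, hMUM, hr, by rwa [iterAntecedent_zero], ?_, 1, 1, zero_le_one,
      CoeffBound.one, ?_⟩
    · rw [hMatrix_zero h0]; exact CoeffBound.one
    · rw [hMatrix_zero h0, mul_one]
  | succ m ih =>
    obtain ⟨M, hMint, hMM, hMr, hMY, hH, c, G, hc, hG, hHG⟩ := ih
    set Z := iterAntecedent m Y with hZ
    have hZ0 : evalZero Z = 1 := evalZero_iterAntecedent m h0
    have hMc := coeffBound_companion hMint
    have hcomp := companion_antecedentOp hMY hZ0
    have hr' : HasUnitRadius (antecedentOp Z).companion := by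
      rw [hcomp]; exact hMr.antecedentMat hMc hMY hZ0
    have hF := coeffBound_frobMat hMc hMY
    have hF0 := evalZero_frobMat hZ0
    obtain ⟨d, hd, hdb⟩ := exists_coeffBound_const (constPowDiag n (p : ℚ_[p])⁻¹)
    rw [← powDiag_eq_map] at hdb
    have hinv : hMatrix 1 Z * (powDiag n (p : ℚ_[p])⁻¹ * frobMat Z) = 1 := by
      rw [hMatrix_one hZ0, mul_assoc, ← mul_assoc (powDiag n _),
        powDiag_mul_inv natCast_p_ne_zero, one_mul,
        inv_mul_of_isUnit (isUnit_of_evalZero_eq_one hF0)]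
    have hb1 : CoeffBound 1 (hMatrix 1 Z) := by
      rw [hMatrix_one hZ0]
      exact (hF.inv hF0).mul_integral coeffBound_powDiag_p
    refine ⟨antecedentOp Z, hr'.isIntegral hn, isMUM_antecedentOp hZ0, hr', ?_, ?_,
      d * 1 * c, substFrob p m (powDiag n (p : ℚ_[p])⁻¹ * frobMat Z) * G, by positivity, ?_, ?_⟩
    · rw [hcomp, iterAntecedent_succ]
      exact isLogFreeSolution_antecedent hZ0
    · rw [hMatrix_succ m h0]
      exact hH.mul_integral ((coeffBound_substFrob_iff zero_le_one).2 hb1)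
    · exact ((coeffBound_substFrob_iff (by positivity)).2 (hdb.mul hd zero_le_one hF)).mul
        (by positivity) hc hG
    · rw [hMatrix_succ m h0, mul_assoc, ← mul_assoc (substFrob p m _), ← substFrob_mul, hinv,
        substFrob_one, one_mul, hHG]

/-! ### The differential equation and the norm of `H_m` -/

theorem hMatrix_mul_substFrob (m : ℕ) {Y : SeriesMat p n} (h0 : evalZero Y = 1) :
    hMatrix m Y * substFrob p m (iterAntecedent m Y) = Y * powDiag n ((p : ℚ_[p]) ^ m) := by
  have hpm : (p : ℚ_[p]) ^ m ≠ 0 := pow_ne_zero _ natCast_p_ne_zero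
  rw [hMatrix, iterAntecedent, substFrob_mul, substFrob_mul, substFrob_powDiag, substFrob_powDiag]
  set W := substFrob p m (Y.map ((cartier p)^[m])) with hW
  have hWu : IsUnit W := isUnit_substFrob_cartier m m h0
  calc _ = Y * (W⁻¹ * ((powDiag n ((p : ℚ_[p]) ^ m) * powDiag n ((p : ℚ_[p]) ^ m)⁻¹) * W)) *
        powDiag n ((p : ℚ_[p]) ^ m) := by simp only [mul_assoc]
    _ = _ := by rw [powDiag_mul_inv hpm, one_mul, inv_mul_of_isUnit hWu, mul_one]

theorem map_C_smul (c : ℚ_[p]) (N : ConstMat p n) :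
    (c • N).map (PowerSeries.C (R := ℚ_[p])) = c • N.map PowerSeries.C := by
  refine Matrix.ext fun i j => ?_
  rw [Matrix.map_apply, Matrix.smul_apply, Matrix.smul_apply, Matrix.map_apply, smul_eq_mul,
    map_mul, PowerSeries.smul_eq_C_mul]

theorem map_delta_hMatrix (m : ℕ) {A B Y : SeriesMat p n}
    (hY : IsLogFreeSolution A (shiftMat p n) Y) (h0 : evalZero Y = 1)
    (hZ : IsLogFreeSolution B (shiftMat p n) (iterAntecedent m Y)) :
    (hMatrix m Y).map (delta p) =
      A * hMatrix m Y - (p : ℚ_[p]) ^ m • (hMatrix m Y * substFrob p m B) := by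
  set H := hMatrix m Y with hH
  set Z := iterAntecedent m Y with hZdef
  set D := powDiag n ((p : ℚ_[p]) ^ m) with hD
  set N : SeriesMat p n := (shiftMat p n).map PowerSeries.C with hN
  have hHZ : H * substFrob p m Z = Y * D := hMatrix_mul_substFrob m h0
  have hDN : (p : ℚ_[p]) ^ m • (D * N) = N * D := by
    have h1 := congrArg (fun M : ConstMat p n => M.map (PowerSeries.C (R := ℚ_[p])))
      (shiftMat_mul_constPowDiag (n := n) ((p : ℚ_[p]) ^ m))
    simp only [map_C_mul, ← powDiag_eq_map] at h1
    rw [← hN, ← hD] at h1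
    rw [h1, map_C_smul, map_C_mul, hN, hD, powDiag_eq_map]
  have hder : H.map (delta p) * substFrob p m Z +
      (p : ℚ_[p]) ^ m • (H * substFrob p m (Z.map (delta p))) = Y.map (delta p) * D := by
    have h1 := congrArg (fun M : SeriesMat p n => M.map (delta p)) hHZ
    simp only [map_delta_mul, map_delta_substFrob] at h1
    rw [mul_smul_comm] at h1
    rw [h1, hD, powDiag_eq_map, map_delta_const, mul_zero, add_zero]
  have hB : substFrob p m B * substFrob p m Z =
      substFrob p m (Z.map (delta p)) + substFrob p m Z * N := by
    rw [← substFrob_mul, ← hZ.delta_eq, substFrob_add, substFrob_mul, substFrob_const]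
  have hu := substFrob_isUnit (m := m) hZ.isUnit
  refine hu.mul_right_cancel ?_
  have hAH : A * H * substFrob p m Z = Y.map (delta p) * D + Y * (N * D) := by
    rw [mul_assoc, hHZ, ← mul_assoc, ← hY.delta_eq, add_mul, mul_assoc]
  have hHB : (p : ℚ_[p]) ^ m • (H * substFrob p m B) * substFrob p m Z =
      (p : ℚ_[p]) ^ m • (H * substFrob p m (Z.map (delta p))) + Y * (N * D) := by
    rw [smul_mul_assoc, mul_assoc, hB, mul_add, smul_add, ← mul_assoc H, hHZ, mul_assoc Y,
      ← mul_smul_comm _ Y, hDN]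
  rw [sub_mul, hAH, hHB, ← hder]
  abel

theorem evalZero_hMatrix (m : ℕ) {Y : SeriesMat p n} (h0 : evalZero Y = 1) :
    evalZero (hMatrix m Y) = constPowDiag n ((p : ℚ_[p]) ^ m) := by
  have h1 := congrArg evalZero (hMatrix_mul_substFrob m h0)
  rw [evalZero_mul, evalZero_mul, evalZero_substFrob, evalZero_iterAntecedent m h0, h0, mul_one,
    one_mul, powDiag_eq_map] at h1
  rw [h1]
  ext i j
  simp [evalZero]

theorem matNorm_hMatrix (hn : 1 ≤ n) (m : ℕ) {Y : SeriesMat p n} (h0 : evalZero Y = 1)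
    (hH : CoeffBound 1 (hMatrix m Y)) : matNorm p (hMatrix m Y) = 1 := by
  refine le_antisymm ?_ ?_
  · rw [← ENNReal.ofReal_one]
    exact (matNorm_le_ofReal_iff zero_le_one).2 hH
  · have h1 : PowerSeries.coeff 0 (hMatrix m Y ⟨0, hn⟩ ⟨0, hn⟩) = 1 := by
      have h2 := congrFun (congrFun (evalZero_hMatrix m h0) ⟨0, hn⟩) ⟨0, hn⟩
      simpa [evalZero, constPowDiag] using h2
    calc (1 : ℝ≥0∞) = ‖PowerSeries.coeff 0 (hMatrix m Y ⟨0, hn⟩ ⟨0, hn⟩)‖ₑ := by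
          rw [h1, ← ofReal_norm, norm_one, ENNReal.ofReal_one]
      _ ≤ gaussNorm p (hMatrix m Y ⟨0, hn⟩ ⟨0, hn⟩) :=
          le_iSup (fun k => ‖PowerSeries.coeff k (hMatrix m Y ⟨0, hn⟩ ⟨0, hn⟩)‖ₑ) 0
      _ ≤ matNorm p (hMatrix m Y) :=
          le_iSup_of_le (f := fun i => ⨆ j, gaussNorm p (hMatrix m Y i j)) ⟨0, hn⟩
            (le_iSup (fun j => gaussNorm p (hMatrix m Y ⟨0, hn⟩ j)) ⟨0, hn⟩)

theorem exists_GL_boundedSeries {c d : ℝ} {H G : SeriesMat p n} (hH : CoeffBound c H)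
    (hG : CoeffBound d G) (hHG : H * G = 1) :
    ∃ U : GL (Fin n) (boundedSeries p),
      (U : Matrix (Fin n) (Fin n) (boundedSeries p)).map (boundedSeries p).subtype = H := by
  let H' : Matrix (Fin n) (Fin n) (boundedSeries p) :=
    Matrix.of fun i j => ⟨H i j, (mem_boundedSeries_iff _).2 ⟨c, hH i j⟩⟩
  let G' : Matrix (Fin n) (Fin n) (boundedSeries p) :=
    Matrix.of fun i j => ⟨G i j, (mem_boundedSeries_iff _).2 ⟨d, hG i j⟩⟩
  have hHH : H'.map (boundedSeries p).subtype = H := Matrix.ext fun i j => rfl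
  have hGG : G'.map (boundedSeries p).subtype = G := Matrix.ext fun i j => rfl
  have h1 : H' * G' = 1 := by
    apply Matrix.map_injective (Subring.subtype_injective (boundedSeries p))
    change (H' * G').map (boundedSeries p).subtype =
      (1 : Matrix (Fin n) (Fin n) (boundedSeries p)).map (boundedSeries p).subtype
    rw [Matrix.map_mul, hHH, hGG, hHG, Matrix.map_one _ (map_zero _) (map_one _)]
  exact ⟨⟨H', G', h1, mul_eq_one_comm.1 h1⟩, hHH⟩

end PadicMUM

theorem proposition4p4 (p : ℕ) [Fact p.Prime] (n : ℕ) (hn : 1 ≤ n)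
    (L : MonicDiffOp p n) (hint : L.IsIntegral) (hMUM : L.IsMUM) (hr : 1 ≤ L.radius)
    (Y : Matrix (Fin n) (Fin n) ℚ_[p]⟦X⟧) (hY : IsUniformPart L.companion Y)
    (m : ℕ) (hm : 0 < m) :
    ∃ Lm : MonicDiffOp p n, Lm.IsIntegral ∧ Lm.IsMUM ∧
      -- (a) the fundamental matrix of solutions of the system of `Lm`
      IsFundamentalMatrix Lm.companion
        (toLog (powDiag n ((p : ℚ_[p]) ^ m)⁻¹ * Y.map ((cartier p)^[m]) *
            powDiag n ((p : ℚ_[p]) ^ m)) *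
          zPow (evalZero L.companion)) ∧
      -- (b) the matrix `H_m`: integrality, invertibility, norm and differential equation
      (∀ i j, hMatrix m Y i j ∈ integralSeries p) ∧
      (∃ G : GL (Fin n) (boundedSeries p),
        (G : Matrix (Fin n) (Fin n) (boundedSeries p)).map (boundedSeries p).subtype =
          hMatrix m Y) ∧
      matNorm p (hMatrix m Y) = 1 ∧
      (hMatrix m Y).map (delta p) =
        L.companion * hMatrix m Y -
          (p : ℚ_[p]) ^ m • (hMatrix m Y * substFrob p m Lm.companion) ∧
      -- (c) the radius of convergence of `Lm`
      1 ≤ Lm.radius := by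
  have hA := coeffBound_companion hint
  have hN := evalZero_companion hMUM
  obtain ⟨hs, h0⟩ := (isUniformPart_iff hN shiftMat_pow_self).1 hY
  obtain ⟨Lm, hLint, hLM, hLr, hZ, hH, c, G, _, hG, hHG⟩ :=
    exists_iterated_antecedent hn hint hMUM (hasUnitRadius_of_one_le_radius hA hr) hs h0 m
  have hNm := evalZero_companion hLM
  refine ⟨Lm, hLint, hLM, ⟨iterAntecedent m Y, ?_, ?_⟩, coeffBound_one_iff.1 hH,
    exists_GL_boundedSeries hH hG hHG, matNorm_hMatrix hn m h0 hH, map_delta_hMatrix m hs h0 hZ,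
    hLr.one_le_radius⟩
  · exact (isUniformPart_iff hNm shiftMat_pow_self).2 ⟨hZ, evalZero_iterAntecedent m h0⟩
  · rw [hN, hNm, iterAntecedent]
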